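/- Conventions. Let $\mathbb K\in\{\mathbb R,\mathbb C\}$ and let $X$ be a Banach space over $\mathbb K$. "$\rightharpoonup$" is weak convergence; for operators, $g_k\rightharpoonup 0$ means $g_kx\rightharpoonup 0$ for every $x\in X$. "Linear isometry" means surjective linear isometry of $X$. $X$ is uniformly convex if for every $\varepsilon>0$ there is $\eta>0$ with $\|x+y\|\le 2-\eta$ whenever $\|x\|=\|y\|=1$, $\|x-y\|\ge\varepsilon$. It is uniformly smooth if for every $\varepsilon>0$ there is $\eta>0$ with $\|x+y\|+\|x-y\|\le 2+\varepsilon\|y\|$ whenever $\|x\|=1$, $\|y\|\le\eta$. It satisfies Opial's condition if $x_n\rightharpoonup a$ implies $\liminf\|x_n-a\|\le\liminf\|x_n-y\|$ for all $y\in X$. The modulus of convexity is $$\delta(\varepsilon)=\inf\Big\{1-\Big\|\frac{x+y}2\Big\| : \|x\|=\|y\|=1,\ \|x-y\|=\varepsilon\Big\},\qquad 0\le\varepsilon\le2$$ (with $\inf\emptyset=0$, which occurs only if $\dim_{\mathbb R}X\le1$). Let $D\ni I$ be a set of linear isometries. A sequence $(r_k)$ converges $D$-weakly to $0$ if $g_k^{-1}r_k\rightharpoonup0$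 for every sequence $(g_k)\subset D$. A profile decomposition (with respect to $D$) of a sequence $(u_k)$ along a subsequence $(u_{k_j})_{j}$ consists of a finite or infinite index set $S\subset\mathbb N=\{1,2,\dots\}$ with $1\in S$, profiles $w^{(n)}\in X$, gauges $(g^{(n)}_j)_{j}\subset D$ ($n\in S$) and a sequence $(r_j)$ converging $D$-weakly to $0$, such that $g^{(1)}_j=I$ for all $j$, $(g_j^{(n)})^{-1}g_j^{(m)}\rightharpoonup0$ as $j\to\infty$ whenever $m\ne n$ in $S$, and $$u_{k_j}=\sum_{n\in S}g_j^{(n)}w^{(n)}+r_j\quad\text{for every }j,$$ where the series converges in $X$ unconditionally and uniformly in $j$. (Profiles may be zero.) A continuous injective linear imbedding of $X$ into a Banach space $Y$ is $D$-cocompact if every sequence in $X$ that converges $D$-weakly to $0$ converges to $0$ in the norm of $Y$. Theorem. Let $X$ be a uniformly convex and uniformly smooth Banach space that satisfies Opial's condition. Let $D_0$ be a group of linear isometries of $X$ with the property (*) if $(g_k)\subset D_0$ and $g_k\not\rightharpoonup0$, then there is a subsequence $(k_j)$ such that both $(g_{k_j})$ and $(g_{k_j}^{-1})$ converge strongly (i.e.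 pointwise in norm), and let $D\ni I$ be a subset of $D_0$. Then: 1. Every bounded sequence in $X$ admits a profile decomposition with respect to $D$ along some subsequence. 2. If $\|u_k\|\le1$ for all $k$, then every profile decomposition of $(u_k)$ with respect to $D$ along a subsequence satisfies $\|w^{(n)}\|\le2$ for all $n\in S$ and $$\limsup_{j\to\infty}\|r_j\|+\sum_{n\in S}\delta(\|w^{(n)}\|)\le1 .$$ 3. If $X$ is $D$-cocompactly imbedded into a Banach space $Y$, then in every profile decomposition of a bounded sequence of $X$ along a subsequence the remainder $r_j$ converges to zero in the norm of $Y$. -/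

import Mathlib

open Filter Topology

universe u v

/-- Weak convergence `x k ⇀ a` of a sequence: `f (x k) → f a` for every bounded linear
functional `f`. -/
def WeaklyConverges (𝕜 : Type*) [RCLike 𝕜] {X : Type*} [NormedAddCommGroup X]
    [NormedSpace 𝕜 X] (x : ℕ → X) (a : X) : Prop :=
  ∀ f : StrongDual 𝕜 X, Tendsto (fun k => f (x k)) atTop (𝓝 (f a))

/-- Uniform smoothness: for every `ε > 0` there is `η > 0` such that
`‖x + y‖ + ‖x - y‖ ≤ 2 + ε ‖y‖` whenever `‖x‖ = 1` and `‖y‖ ≤ η`. -/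
def IsUniformlySmooth (X : Type*) [NormedAddCommGroup X] : Prop :=
  ∀ ε : ℝ, 0 < ε → ∃ η : ℝ, 0 < η ∧
    ∀ x y : X, ‖x‖ = 1 → ‖y‖ ≤ η → ‖x + y‖ + ‖x - y‖ ≤ 2 + ε * ‖y‖

/-- The modulus of convexity
`δ(ε) = inf { 1 - ‖(x + y) / 2‖ : ‖x‖ = ‖y‖ = 1, ‖x - y‖ = ε }`, for `0 ≤ ε ≤ 2`.
The infimum runs over a nonempty set when the real dimension of `X` is at least two;
the infimum of the empty set is `0`. -/
noncomputable def modulusOfConvexity (X : Type*) [NormedAddCommGroup X] (ε : ℝ) : ℝ :=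
  sInf {t : ℝ | ∃ x y : X, ‖x‖ = 1 ∧ ‖y‖ = 1 ∧ ‖x - y‖ = ε ∧ t = 1 - ‖x + y‖ / 2}

/-- Opial's condition: if `x n ⇀ a`, then `liminf ‖x n - a‖ ≤ liminf ‖x n - y‖` for every `y`.
The norms are taken in `[0, ∞]`, so that the lower limits always exist. -/
def SatisfiesOpial (𝕜 : Type*) [RCLike 𝕜] (X : Type*) [NormedAddCommGroup X]
    [NormedSpace 𝕜 X] : Prop :=
  ∀ (x : ℕ → X) (a : X), WeaklyConverges 𝕜 x a → ∀ y : X,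
    liminf (fun n => ‖x n - a‖ₑ) atTop ≤ liminf (fun n => ‖x n - y‖ₑ) atTop

section Gauges

variable {𝕜 : Type*} [RCLike 𝕜] {X : Type*} [NormedAddCommGroup X] [NormedSpace 𝕜 X]

/-- `g k ⇀ 0` in the operator sense: `g k x ⇀ 0` for every `x`. -/
def OpWeaklyNull (g : ℕ → X ≃ₗᵢ[𝕜] X) : Prop :=
  ∀ x : X, WeaklyConverges 𝕜 (fun k => g k x) 0

/-- The sequence of operators `g` converges strongly, that is, pointwise in norm. -/
def OpStronglyConvergent (g : ℕ → X ≃ₗᵢ[𝕜] X) : Prop :=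
  ∀ x : X, ∃ y : X, Tendsto (fun k => g k x) atTop (𝓝 y)

/-- Property (*) of a group `D₀` of linear isometries: every sequence in `D₀` that is not weakly
null has a subsequence that converges strongly together with the sequence of its inverses. -/
def HasPropertyStar (D₀ : Subgroup (X ≃ₗᵢ[𝕜] X)) : Prop :=
  ∀ g : ℕ → X ≃ₗᵢ[𝕜] X, (∀ k, g k ∈ D₀) → ¬ OpWeaklyNull g →
    ∃ φ : ℕ → ℕ, StrictMono φ ∧
      OpStronglyConvergent (fun j => (g (φ j))⁻¹) ∧ OpStronglyConvergent (fun j => g (φ j))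

/-- `u k` converges to zero `D`-weakly: `(g k)⁻¹ (u k) ⇀ 0` for every sequence `g` in `D`. -/
def DWeaklyNull (D : Set (X ≃ₗᵢ[𝕜] X)) (u : ℕ → X) : Prop :=
  ∀ g : ℕ → X ≃ₗᵢ[𝕜] X, (∀ k, g k ∈ D) → WeaklyConverges 𝕜 (fun k => (g k)⁻¹ (u k)) 0

/-- `u k = ∑ n, g n k (w n) + r k` is a profile decomposition of the sequence `u` itself, with
gauges `g n k ∈ D`, profiles `w n` and remainder `r k`. The first index is `0`. The sum runs over
an index set `S ⊆ ℕ` with `0 ∈ S` which may be finite: the profiles off `S` vanish, and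
the decoupling concerns the gauges with index in `S`. -/
structure IsProfileDecomposition (D : Set (X ≃ₗᵢ[𝕜] X)) (u : ℕ → X) (S : Set ℕ)
    (g : ℕ → ℕ → X ≃ₗᵢ[𝕜] X) (w : ℕ → X) (r : ℕ → X) : Prop where
  gauge_mem : ∀ n k, g n k ∈ D
  zero_mem : 0 ∈ S
  gauge_zero : ∀ k, g 0 k = 1
  profile_eq_zero : ∀ n, n ∉ S → w n = 0
  decoupled : ∀ n ∈ S, ∀ m ∈ S, m ≠ n → OpWeaklyNull (fun k => (g n k)⁻¹ * g m k)
  /-- The series converges unconditionally (along all finite sets of indices), uniformly in `k`. -/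
  tendstoUniformly : TendstoUniformly (fun (F : Finset ℕ) (k : ℕ) => ∑ n ∈ F, g n k (w n))
    (fun k => ∑' n, g n k (w n)) atTop
  eq_sum_add : ∀ k, u k = ∑' n, g n k (w n) + r k
  remainder : DWeaklyNull D r

/-- The continuous imbedding `j : X → Y` is cocompact relative to `D`: it is injective, and every
sequence that converges to zero `D`-weakly in `X` converges to zero in the norm of `Y`. -/
structure IsCocompactImbedding (D : Set (X ≃ₗᵢ[𝕜] X)) {Y : Type*} [NormedAddCommGroup Y]
    [NormedSpace 𝕜 Y] (j : X →L[𝕜] Y) : Prop where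
  injective : Function.Injective j
  tendsto_zero : ∀ u : ℕ → X, DWeaklyNull D u → Tendsto (fun k => ‖j (u k)‖) atTop (𝓝 0)

end Gauges

/-! ### Uniform convexity and the modulus of convexity -/

section Geometry

/-! Opial's condition turns geometry into energy estimates. If `x k ⇀ a` and the upper limit of `‖x
k‖` is at most `t ≤ 1`, comparing `a` with `0` and then with `a / 2` bounds the upper limit of `‖x k
- a‖` first by `t`, then by that of the midpoint of `x k` and `x k - a`. These two points lie
asymptotically in the `t`-ball and differ by `a`, so the bound is `t - δ(‖a‖)`. Applied in the
moving gauges, each removal of a profile costs `δ(‖w n‖)`, and summation yields the energy bound of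
any profile decomposition.

For existence, profiles are extracted greedily: at each stage a weak limit of the current remainder
in some gauge is subtracted, with norm at least half the supremum of all such limits. Uniform
smoothness makes the duality map uniformly continuous. Hence isometries with strongly convergent
inverses preserve weak nullity of bounded sequences, and property (*) forces the gauges of nonzero
profiles to decouple (`HasPropertyStar.opWeaklyNull`).

The remaining difficulty is the uniform unconditional convergence of the series. By Opial, dropping
terms from a sum of decoupled concentrations does not raise the upper limit of its norm. So the
limiting norms of partial sums are close to their supremum, and uniform convexity excludes a tail
that stays large: adding half of it would bring the norm below that of the partial sum
(`exists_forall_eventually_norm_sum_le`). Changing finitely many terms of each gauge sequence makes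
the tails small for all `k` at once. Then `W n → 0`, and greediness makes the remainder `D`-weakly
null. The cocompactness statement is the definition applied to this remainder. -/

theorem exists_pos_forall_norm_add_lt {X : Type*} [NormedAddCommGroup X] [NormedSpace ℝ X]
    [UniformConvexSpace X] (A : ℝ) {ε : ℝ} (hε : 0 < ε) :
    ∃ η : ℝ, 0 < η ∧ ∀ x y : X, ‖x‖ ≤ A + η → ‖y‖ ≤ A + η → ε ≤ ‖x - y‖ →
      ‖x + y‖ < 2 * (A - η) := by
  rcases lt_or_ge A 0 with hA | hA
  · refine ⟨-A / 2, by linarith, fun x y hx _ _ => ?_⟩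
    linarith [norm_nonneg x]
  obtain ⟨δ, hδ, H⟩ := exists_forall_closed_ball_dist_add_le_two_mul_sub X (half_pos hε) A
  -- Rescaling by `A / (A + η)` into the `A`-ball moves each point by at most `η`. The distance thus
  -- loses at most `2 * η ≤ ε / 2`, and the strict bound on the sum needs `4 * η < δ`.
  set η := min (δ / 5) (ε / 4) with hη
  have hη0 : 0 < η := by positivity
  have hη1 : η ≤ δ / 5 := min_le_left _ _
  have hη2 : η ≤ ε / 4 := min_le_right _ _
  refine ⟨η, hη0, fun x y hx hy hxy => ?_⟩
  have hpos : 0 < A + η := by linarith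
  have key : ∀ z : X, ‖z‖ ≤ A + η → ‖(A / (A + η)) • z‖ ≤ A ∧ ‖z - (A / (A + η)) • z‖ ≤ η := by
    intro z hz
    have h0 : 0 ≤ A / (A + η) := by positivity
    constructor
    · rw [norm_smul, Real.norm_of_nonneg h0]
      calc A / (A + η) * ‖z‖ ≤ A / (A + η) * (A + η) := by gcongr
        _ = A := by field_simp
    · have : z - (A / (A + η)) • z = (η / (A + η)) • z := by
        rw [show η / (A + η) = 1 - A / (A + η) by field_simp; ring, sub_smul, one_smul]
      rw [this, norm_smul, Real.norm_of_nonneg (by positivity)]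
      calc η / (A + η) * ‖z‖ ≤ η / (A + η) * (A + η) := by gcongr
        _ = η := by field_simp
  obtain ⟨hx1, hx2⟩ := key x hx
  obtain ⟨hy1, hy2⟩ := key y hy
  set x' := (A / (A + η)) • x
  set y' := (A / (A + η)) • y
  have h1 : ‖x - y‖ ≤ ‖x' - y'‖ + ‖x - x'‖ + ‖y - y'‖ := by
    calc ‖x - y‖ = ‖(x' - y') + (x - x') - (y - y')‖ := by congr 1; abel
      _ ≤ _ := (norm_sub_le _ _).trans (by gcongr; exact norm_add_le _ _)
  have h2 : ‖x + y‖ ≤ ‖x' + y'‖ + ‖x - x'‖ + ‖y - y'‖ := by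
    calc ‖x + y‖ = ‖(x' + y') + (x - x') + (y - y')‖ := by congr 1; abel
      _ ≤ _ := norm_add₃_le
  have := H hx1 hy1 (by linarith)
  linarith

theorem modulusOfConvexity_nonneg (X : Type*) [NormedAddCommGroup X] (s : ℝ) :
    0 ≤ modulusOfConvexity X s := by
  refine Real.sInf_nonneg ?_
  rintro t ⟨x, y, hx, hy, -, rfl⟩
  linarith [norm_add_le x y]

theorem modulusOfConvexity_le {X : Type*} [NormedAddCommGroup X] {x y : X}
    (hx : ‖x‖ = 1) (hy : ‖y‖ = 1) : modulusOfConvexity X ‖x - y‖ ≤ 1 - ‖x + y‖ / 2 := by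
  refine csInf_le ⟨0, ?_⟩ ⟨x, y, hx, hy, rfl, rfl⟩
  rintro t ⟨x, y, hx, hy, -, rfl⟩
  linarith [norm_add_le x y]

variable {X : Type*} [NormedAddCommGroup X] [NormedSpace ℝ X]

theorem modulusOfConvexity_zero : modulusOfConvexity X 0 = 0 := by
  rcases subsingleton_or_nontrivial X with h | h
  · have : {t : ℝ | ∃ x y : X, ‖x‖ = 1 ∧ ‖y‖ = 1 ∧ ‖x - y‖ = 0 ∧ t = 1 - ‖x + y‖ / 2} = ∅ := by
      ext t
      simp only [Set.mem_ofPred_eq, Set.mem_empty_iff_false, iff_false]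
      rintro ⟨x, y, hx, -⟩
      rw [Subsingleton.elim x 0, norm_zero] at hx
      exact zero_ne_one hx
    rw [modulusOfConvexity, this, Real.sInf_empty]
  · obtain ⟨x, hx⟩ := exists_norm_eq X zero_le_one
    refine le_antisymm ?_ (modulusOfConvexity_nonneg X 0)
    have := modulusOfConvexity_le hx hx
    rw [sub_self, norm_zero, ← two_smul ℝ x, norm_smul, hx] at this
    norm_num at this
    exact this

theorem two_sub_norm_sub_le {x y : X} (hy : ‖y‖ = 1) : 2 - ‖x - y‖ ≤ ‖x + y‖ := by
  have := norm_sub_le (x + y) (x - y)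
  rw [show x + y - (x - y) = (2 : ℝ) • y by rw [two_smul]; abel, norm_smul, hy] at this
  norm_num at this
  linarith

theorem modulusOfConvexity_le_half {s : ℝ} (hs : 0 ≤ s) : modulusOfConvexity X s ≤ s / 2 := by
  rcases Set.eq_empty_or_nonempty {t : ℝ | ∃ x y : X, ‖x‖ = 1 ∧ ‖y‖ = 1 ∧ ‖x - y‖ = s ∧
    t = 1 - ‖x + y‖ / 2} with h | ⟨-, x, y, hx, hy, rfl, -⟩
  · rw [modulusOfConvexity, h, Real.sInf_empty]
    positivity
  · linarith [modulusOfConvexity_le hx hy, two_sub_norm_sub_le (x := x) hy]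

/-- Let `f` norm `a + b`, and let `v = b - a`. Since `b` is interior to the ball, `v` can be rotated
slightly inside the sphere of radius `s`. Rotating towards `a + b` would increase `f`, hence the
maximum, unless `|f v| = s`. The value `-s` gives the claim, and `s` is impossible by strict
convexity. -/
theorem norm_add_le_two_sub_of_isMax [StrictConvexSpace ℝ X] (F : Submodule ℝ X) {a b : X}
    (ha : a ∈ F) (hb : b ∈ F) (ha1 : ‖a‖ = 1) (hb1 : ‖b‖ < 1) (hab : a + b ≠ 0) (hne : a ≠ b)
    (hmax : ∀ b' ∈ F, ‖b'‖ ≤ 1 → ‖a - b'‖ = ‖a - b‖ → ‖a + b'‖ ≤ ‖a + b‖) :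
    ‖a + b‖ ≤ 2 - ‖a - b‖ := by
  set s := ‖a - b‖ with hs
  set M := ‖a + b‖ with hM
  have hs0 : 0 < s := norm_pos_iff.2 (sub_ne_zero.2 hne)
  have hM0 : 0 < M := norm_pos_iff.2 hab
  have hs2 : s < 2 := by linarith [norm_sub_le a b]
  obtain ⟨f, hf1, hfm⟩ := exists_dual_vector ℝ (a + b) hM0.ne'
  have hfm' : f (a + b) = M := by simpa using hfm
  have hfle : ∀ z : X, |f z| ≤ ‖z‖ := fun z => by simpa [hf1] using f.le_opNorm z
  set v := b - a with hv
  have hvs : ‖v‖ = s := norm_sub_rev _ _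
  set e := M⁻¹ • (a + b) with he
  have he1 : ‖e‖ = 1 := by rw [he, norm_smul, norm_inv, Real.norm_of_nonneg hM0.le]; field_simp; rfl
  have hfe : f e = 1 := by rw [he, map_smul, hfm', smul_eq_mul]; field_simp
  have heF : e ∈ F := F.smul_mem _ (F.add_mem ha hb)
  have hfv := abs_le.1 (hvs ▸ hfle v)
  have hab2 : (2 : ℝ) • a = M • e - v := by
    rw [he, smul_inv_smul₀ hM0.ne', two_smul, hv]; abel
  have hbb2 : (2 : ℝ) • b = M • e + v := by
    rw [he, smul_inv_smul₀ hM0.ne', two_smul, hv]; abel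
  rcases eq_or_lt_of_le hfv.1 with h | h
  · have h1 : f ((2 : ℝ) • a) = M + s := by rw [hab2, map_sub, map_smul, hfe, ← h]; simp
    have h2 := (abs_le.1 (hfle ((2 : ℝ) • a))).2
    rw [h1, norm_smul, ha1] at h2
    norm_num at h2
    linarith
  rcases eq_or_lt_of_le hfv.2 with h' | h'
  -- Equality `f v = ‖v‖` aligns `v` with `e`, so `2a = (M - s)e` and `2b = (M + s)e`. This makes
  -- `‖b‖ ≥ ‖a‖ = 1`.
  · exfalso
    have hse : ‖s • e‖ = s := by rw [norm_smul, he1, Real.norm_of_nonneg hs0.le, mul_one]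
    have hve : v = s • e := by
      refine eq_of_norm_eq_of_norm_add_eq (hvs.trans hse.symm) (le_antisymm (norm_add_le _ _) ?_)
      have := (abs_le.1 (hfle (v + s • e))).2
      rw [map_add, map_smul, hfe, h', smul_eq_mul, mul_one] at this
      rw [hvs, hse]; exact this
    rw [hve, ← sub_smul] at hab2
    rw [hve, ← add_smul] at hbb2
    have h1 := congrArg norm hab2
    have h2 := congrArg norm hbb2
    rw [norm_smul, norm_smul, he1, ha1] at h1
    rw [norm_smul, norm_smul, he1] at h2
    simp only [Real.norm_eq_abs, mul_one, abs_two] at h1 h2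
    rw [abs_of_pos (by linarith)] at h2
    rcases abs_cases (M - s) with h3 | h3 <;> linarith
  exfalso
  -- The competitor is `a + s (v + t e) / ‖v + t e‖`, which remains in the open unit ball for small
  -- `t > 0`. Maximality gives `s * t ≤ f v * (p - s)`, contradicting `|p - s| ≤ t` and `|f v| < s`.
  have hcont : ContinuousAt (fun t : ℝ => ‖a + (s / ‖v + t • e‖) • (v + t • e)‖) 0 := by
    have : ‖v + (0 : ℝ) • e‖ ≠ 0 := by rw [zero_smul, add_zero, hvs]; exact hs0.ne'
    fun_prop (disch := assumption)
  have h0 : ‖a + (s / ‖v + (0 : ℝ) • e‖) • (v + (0 : ℝ) • e)‖ < 1 := by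
    rw [zero_smul, add_zero, hvs, div_self hs0.ne', one_smul, hv, add_sub_cancel]; exact hb1
  have hev := hcont.eventually (gt_mem_nhds h0)
  have hev' := (hev.filter_mono nhdsWithin_le_nhds).and
    (Ioo_mem_nhdsGT hs0 : ∀ᶠ t in 𝓝[>] (0 : ℝ), t ∈ Set.Ioo 0 s)
  obtain ⟨t, ht1, ht0, hts⟩ := hev'.exists
  have hte : ‖t • e‖ = t := by rw [norm_smul, he1, Real.norm_of_nonneg ht0.le, mul_one]
  have hl : s - t ≤ ‖v + t • e‖ := by
    have := norm_sub_norm_le v (-(t • e))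
    rw [sub_neg_eq_add, norm_neg, hte, hvs] at this; exact this
  have hu : ‖v + t • e‖ ≤ s + t := (norm_add_le _ _).trans (by rw [hte, hvs])
  set p := ‖v + t • e‖ with hp
  have hp0 : 0 < p := by linarith
  have hle := hmax (a + (s / p) • (v + t • e))
    (F.add_mem ha (F.smul_mem _ (F.add_mem (F.sub_mem hb ha) (F.smul_mem _ heF)))) ht1.le (by
      rw [sub_add_cancel_left, norm_neg, norm_smul, ← hp, Real.norm_of_nonneg (by positivity)]
      field_simp)
  have h2 := (abs_le.1 (hfle (a + (a + (s / p) • (v + t • e))))).2.trans hle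
  have h3 : M = f a + (f a + f v) := by rw [← hfm', ← map_add, ← map_add, hv]; congr 1; abel
  rw [map_add, map_add, map_smul, map_add, map_smul, hfe] at h2
  simp only [smul_eq_mul, mul_one] at h2
  have h4 : s / p * (f v + t) ≤ f v := by linarith
  rw [div_mul_eq_mul_div, div_le_iff₀ hp0] at h4
  have h5 : f v * (p - s) < s * t := by
    have : |f v * (p - s)| < s * t := by
      rw [abs_mul]
      calc |f v| * |p - s| ≤ |f v| * t := by gcongr; rw [abs_le]; constructor <;> linarith
        _ < s * t := by gcongr; rw [abs_lt]; exact ⟨h, h'⟩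
    exact (abs_lt.1 this).2
  linarith

/-- The modulus is defined by unit vectors only; the same bound holds in the ball. In the span of
`x` and `y`, compactness provides a pair maximizing `‖a + b‖` at the given distance `s`. Two unit
vectors satisfy the bound by definition. If only one is interior, the sum is at most `2 - s`, which
suffices because `δ(s) ≤ s / 2`. Two interior points could both be shifted along `a + b`, against
maximality. -/
theorem norm_add_div_two_le_one_sub_modulusOfConvexity [StrictConvexSpace ℝ X] {x y : X}
    (hx : ‖x‖ ≤ 1) (hy : ‖y‖ ≤ 1) : ‖x + y‖ / 2 ≤ 1 - modulusOfConvexity X ‖x - y‖ := by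
  rcases eq_or_ne x y with rfl | hxy
  · rw [sub_self, norm_zero, modulusOfConvexity_zero]
    linarith [norm_add_le x x]
  set T := {t : ℝ | ∃ x' y' : X, ‖x'‖ = 1 ∧ ‖y'‖ = 1 ∧ ‖x' - y'‖ = ‖x - y‖ ∧
    t = 1 - ‖x' + y'‖ / 2} with hT
  rcases T.eq_empty_or_nonempty with h | ⟨-, x', y', hx', hy', hxy', -⟩
  · rw [modulusOfConvexity, ← hT, h, Real.sInf_empty]
    linarith [norm_add_le x y]
  have hs0 : 0 < ‖x - y‖ := norm_pos_iff.2 (sub_ne_zero.2 hxy)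
  have hδ := modulusOfConvexity_le hx' hy'
  have hsum : 2 - ‖x - y‖ ≤ ‖x' + y'‖ := hxy' ▸ two_sub_norm_sub_le hy'
  rw [hxy'] at hδ
  rcases eq_or_ne (x + y) 0 with h0 | h0
  · rw [h0, norm_zero]; linarith [norm_nonneg (x' + y')]
  let F : Submodule ℝ X := Submodule.span ℝ {x, y}
  have hxF : x ∈ F := Submodule.subset_span (by simp)
  have hyF : y ∈ F := Submodule.subset_span (by simp)
  have : FiniteDimensional ℝ F := FiniteDimensional.span_of_finite ℝ (by simp)
  have : ProperSpace F := FiniteDimensional.proper ℝ F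
  let K : Set (F × F) := {p | ‖p.1‖ ≤ 1 ∧ ‖p.2‖ ≤ 1 ∧ ‖p.1 - p.2‖ = ‖x - y‖}
  have hK : IsCompact K := by
    refine IsCompact.of_isClosed_subset
      ((isCompact_closedBall (0 : F) 1).prod (isCompact_closedBall (0 : F) 1)) ?_ ?_
    · have h1 : IsClosed {p : F × F | ‖p.1‖ ≤ 1} := isClosed_le (by fun_prop) (by fun_prop)
      have h2 : IsClosed {p : F × F | ‖p.2‖ ≤ 1} := isClosed_le (by fun_prop) (by fun_prop)
      have h3 : IsClosed {p : F × F | ‖p.1 - p.2‖ = ‖x - y‖} :=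
        isClosed_eq (by fun_prop) (by fun_prop)
      exact h1.inter (h2.inter h3)
    · rintro ⟨p, q⟩ ⟨h1, h2, -⟩
      exact ⟨mem_closedBall_zero_iff.2 h1, mem_closedBall_zero_iff.2 h2⟩
  obtain ⟨⟨⟨a, haF⟩, ⟨b, hbF⟩⟩, ⟨ha1, hb1, hab⟩, hmax⟩ := hK.exists_isMaxOn
    (f := fun p : F × F => ‖p.1 + p.2‖) ⟨(⟨x, hxF⟩, ⟨y, hyF⟩), hx, hy, rfl⟩
    (by fun_prop)
  replace hmax : ∀ a' ∈ F, ∀ b' ∈ F, ‖a'‖ ≤ 1 → ‖b'‖ ≤ 1 → ‖a' - b'‖ = ‖x - y‖ →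
      ‖a' + b'‖ ≤ ‖a + b‖ := fun a' ha' b' hb' h1 h2 h3 =>
    hmax (a := (⟨a', ha'⟩, ⟨b', hb'⟩)) ⟨h1, h2, h3⟩
  change ‖a‖ ≤ 1 at ha1
  change ‖b‖ ≤ 1 at hb1
  change ‖a - b‖ = ‖x - y‖ at hab
  have hle := hmax x hxF y hyF hx hy rfl
  have hMpos : 0 < ‖a + b‖ := (norm_pos_iff.2 h0).trans_le hle
  have hne : a ≠ b := by
    rintro rfl
    rw [sub_self, norm_zero] at hab
    exact hs0.ne hab
  have hab0 : a + b ≠ 0 := norm_pos_iff.1 hMpos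
  rcases eq_or_lt_of_le ha1 with ha | ha
  · rcases eq_or_lt_of_le hb1 with hb | hb
    · have := modulusOfConvexity_le ha hb
      rw [hab] at this
      linarith
    · have := norm_add_le_two_sub_of_isMax F haF hbF ha hb hab0 hne
        (fun b' hb' h1 h2 => hmax a haF b' hb' ha1 h1 (h2.trans hab))
      rw [hab] at this
      linarith
  · rcases eq_or_lt_of_le hb1 with hb | hb
    · have := norm_add_le_two_sub_of_isMax F hbF haF hb ha (by rwa [add_comm]) hne.symm
        (fun b' hb' h1 h2 => by
          rw [add_comm, add_comm b]
          exact hmax b' hb' b hbF h1 hb1 (by rw [norm_sub_rev, h2, norm_sub_rev, hab]))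
      rw [norm_sub_rev, hab, add_comm] at this
      linarith
    · exfalso
      set c := min (1 - ‖a‖) (1 - ‖b‖) with hc
      have hc0 : 0 < c := lt_min (by linarith) (by linarith)
      set z := (c / ‖a + b‖) • (a + b) with hz
      have hzn : ‖z‖ = c := by
        rw [hz, norm_smul, Real.norm_of_nonneg (by positivity)]; field_simp
      have hzF : z ∈ F := F.smul_mem _ (F.add_mem haF hbF)
      have h := hmax (a + z) (F.add_mem haF hzF) (b + z) (F.add_mem hbF hzF)
        ((norm_add_le _ _).trans (by linarith [min_le_left (1 - ‖a‖) (1 - ‖b‖)]))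
        ((norm_add_le _ _).trans (by linarith [min_le_right (1 - ‖a‖) (1 - ‖b‖)]))
        (by rw [add_sub_add_right_eq_sub, hab])
      have h' : a + z + (b + z) = (1 + 2 * (c / ‖a + b‖)) • (a + b) := by
        rw [add_smul, one_smul, mul_smul, two_smul, ← hz]; abel
      rw [h', norm_smul, Real.norm_of_nonneg (by positivity)] at h
      have : 0 < 2 * (c / ‖a + b‖) * ‖a + b‖ := by positivity
      linarith

/-- Translating both points by a vector of length `1 - t` along `x + y` reduces to the unit ball and
leaves `x - y` unchanged. Rescaling would alter the argument of the modulus. -/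
theorem norm_add_div_two_le_sub_modulusOfConvexity [StrictConvexSpace ℝ X] {x y : X} {t : ℝ}
    (ht : t ≤ 1) (hx : ‖x‖ ≤ t) (hy : ‖y‖ ≤ t) :
    ‖x + y‖ / 2 ≤ t - modulusOfConvexity X ‖x - y‖ := by
  rcases eq_or_ne (x + y) 0 with h0 | hxy
  · rw [h0, norm_zero]
    linarith [modulusOfConvexity_le_half (X := X) (norm_nonneg (x - y)), norm_sub_le x y]
  have hM : 0 < ‖x + y‖ := norm_pos_iff.2 hxy
  set z := ((1 - t) / ‖x + y‖) • (x + y) with hz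
  have h0 : 0 ≤ 1 - t := by linarith
  have hzn : ‖z‖ = 1 - t := by
    rw [hz, norm_smul, Real.norm_of_nonneg (by positivity)]; field_simp
  have h := norm_add_div_two_le_one_sub_modulusOfConvexity (x := x + z) (y := y + z)
    ((norm_add_le _ _).trans (by linarith)) ((norm_add_le _ _).trans (by linarith))
  have h' : x + z + (y + z) = (1 + 2 * ((1 - t) / ‖x + y‖)) • (x + y) := by
    rw [add_smul, one_smul, mul_smul, two_smul, ← hz]; abel
  rw [add_sub_add_right_eq_sub, h', norm_smul, Real.norm_of_nonneg (by positivity)] at h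
  have : (1 + 2 * ((1 - t) / ‖x + y‖)) * ‖x + y‖ = ‖x + y‖ + 2 * (1 - t) := by
    field_simp
  linarith

end Geometry

/-! ### Weak convergence and Opial's condition -/

section WeakConvergence

variable {𝕜 : Type*} [RCLike 𝕜] {X : Type*} [NormedAddCommGroup X] [NormedSpace 𝕜 X]

namespace WeaklyConverges

theorem add {x y : ℕ → X} {a b : X} (hx : WeaklyConverges 𝕜 x a) (hy : WeaklyConverges 𝕜 y b) :
    WeaklyConverges 𝕜 (fun k => x k + y k) (a + b) := fun f => by
  simpa using (hx f).add (hy f)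

theorem sub {x y : ℕ → X} {a b : X} (hx : WeaklyConverges 𝕜 x a) (hy : WeaklyConverges 𝕜 y b) :
    WeaklyConverges 𝕜 (fun k => x k - y k) (a - b) := fun f => by
  simpa using (hx f).sub (hy f)

theorem const (a : X) : WeaklyConverges 𝕜 (fun _ => a) a := fun _ => tendsto_const_nhds

theorem sum {ι : Type*} {F : Finset ι} {x : ι → ℕ → X} {a : ι → X}
    (h : ∀ i ∈ F, WeaklyConverges 𝕜 (x i) (a i)) :
    WeaklyConverges 𝕜 (fun k => ∑ i ∈ F, x i k) (∑ i ∈ F, a i) := fun f => by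
  simpa using tendsto_finsetSum F fun i hi => h i hi f

theorem congr {x y : ℕ → X} {a : X} (hx : WeaklyConverges 𝕜 x a) (h : x =ᶠ[atTop] y) :
    WeaklyConverges 𝕜 y a := fun f =>
  (hx f).congr' (h.mono fun k hk => by rw [hk])

theorem comp {x : ℕ → X} {a : X} (hx : WeaklyConverges 𝕜 x a) {φ : ℕ → ℕ}
    (hφ : Tendsto φ atTop atTop) : WeaklyConverges 𝕜 (fun k => x (φ k)) a := fun f =>
  (hx f).comp hφ

theorem norm_le {x : ℕ → X} {a : X} (hx : WeaklyConverges 𝕜 x a) {C : ℝ}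
    (h : ∃ᶠ k in atTop, ‖x k‖ ≤ C) : ‖a‖ ≤ C := by
  obtain ⟨f, hf, hfa⟩ := exists_dual_vector'' 𝕜 a
  refine le_of_forall_pos_le_add fun ε hε => ?_
  have h1 : ∀ᶠ k in atTop, ‖f a‖ - ε < ‖f (x k)‖ :=
    (hx f).norm.eventually (lt_mem_nhds (by linarith))
  obtain ⟨k, hk, hk'⟩ := (h.and_eventually h1).exists
  have h2 : ‖f (x k)‖ ≤ ‖x k‖ := by
    simpa using f.le_of_opNorm_le hf (x k)
  rw [hfa, RCLike.norm_ofReal, abs_norm] at hk'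
  linarith

theorem unique {x : ℕ → X} {a b : X} (ha : WeaklyConverges 𝕜 x a) (hb : WeaklyConverges 𝕜 x b) :
    a = b := by
  have h := (ha.sub hb).norm_le (C := 0) (Eventually.frequently (by simp))
  exact sub_eq_zero.1 (norm_le_zero_iff.1 h)

theorem of_tendsto {x : ℕ → X} {a : X} (h : Tendsto x atTop (𝓝 a)) : WeaklyConverges 𝕜 x a :=
  fun f => (f.continuous.tendsto a).comp h

/-- Approximation principle: if `x` is within `ε` of a sequence converging weakly to `a`, for
every `ε > 0`, then `x` converges weakly to `a`. -/
theorem of_approx {x : ℕ → X} {a : X}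
    (h : ∀ ε > 0, ∃ y : ℕ → X, WeaklyConverges 𝕜 y a ∧ ∀ᶠ k in atTop, ‖x k - y k‖ ≤ ε) :
    WeaklyConverges 𝕜 x a := by
  intro f
  rw [Metric.tendsto_nhds]
  intro ε hε
  obtain ⟨y, hy, hxy⟩ := h (ε / 2 / (‖f‖ + 1)) (by positivity)
  filter_upwards [hxy, (Metric.tendsto_nhds.1 (hy f)) (ε / 2) (half_pos hε)] with k h1 h2
  have h3 : ‖f (x k) - f (y k)‖ ≤ ε / 2 := by
    rw [← map_sub]
    calc ‖f (x k - y k)‖ ≤ ‖f‖ * ‖x k - y k‖ := f.le_opNorm _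
      _ ≤ (‖f‖ + 1) * (ε / 2 / (‖f‖ + 1)) := by gcongr; linarith
      _ = ε / 2 := by field_simp
  rw [← dist_eq_norm] at h3
  linarith [dist_triangle (f (x k)) (f (y k)) (f a)]

end WeaklyConverges

/-- Opial's condition as a bound for upper limits. -/
theorem SatisfiesOpial.eventually_norm_sub_le (hO : SatisfiesOpial 𝕜 X) {x : ℕ → X} {a : X}
    (hx : WeaklyConverges 𝕜 x a) (y : X) {s : ℝ} (hs : ∀ᶠ k in atTop, ‖x k - y‖ ≤ s)
    {ε : ℝ} (hε : 0 < ε) : ∀ᶠ k in atTop, ‖x k - a‖ ≤ s + ε := by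
  -- Opial's condition concerns lower limits; applied along a subsequence on which the bound fails,
  -- it controls upper limits.
  by_contra hcon
  obtain ⟨φ, hφ, hφ'⟩ := extraction_of_frequently_atTop
    (not_eventually.1 hcon)
  have hs0 : 0 ≤ s := by
    obtain ⟨k, hk⟩ := hs.exists
    exact (norm_nonneg _).trans hk
  have key := hO _ a (hx.comp hφ.tendsto_atTop) y
  have h1 : ENNReal.ofReal (s + ε) ≤ liminf (fun n => ‖x (φ n) - a‖ₑ) atTop := by
    refine le_liminf_of_le (by isBoundedDefault) (Eventually.of_forall fun n => ?_)
    rw [← ofReal_norm]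
    exact ENNReal.ofReal_le_ofReal (not_le.1 (hφ' n)).le
  have h2 : liminf (fun n => ‖x (φ n) - y‖ₑ) atTop ≤ ENNReal.ofReal s := by
    refine liminf_le_of_frequently_le' (Eventually.frequently ?_)
    filter_upwards [hφ.tendsto_atTop.eventually hs] with n hn
    rw [← ofReal_norm]
    exact ENNReal.ofReal_le_ofReal hn
  have := (ENNReal.ofReal_le_ofReal_iff hs0).1 (h1.trans (key.trans h2))
  linarith

end WeakConvergence

/-! ### Weak compactness in uniformly convex spaces -/

section UniformlyConvex

/-- The distances from `0` to the sets increase to a finite limit `A`. Points of nearly minimal norm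
form a Cauchy sequence: otherwise uniform convexity would put a midpoint, which stays in the convex
set, too close to `0`. This is the form in which reflexivity is used. -/
theorem nonempty_iInter_of_antitone_convex {X : Type*} [NormedAddCommGroup X] [NormedSpace ℝ X]
    [UniformConvexSpace X] [CompleteSpace X] {C : ℕ → Set X} (hanti : Antitone C)
    (hne : ∀ n, (C n).Nonempty) (hclosed : ∀ n, IsClosed (C n)) (hconv : ∀ n, Convex ℝ (C n))
    {B : ℝ} (hB : ∀ x ∈ C 0, ‖x‖ ≤ B) : (⋂ n, C n).Nonempty := by
  let d : ℕ → ℝ := fun n => Metric.infDist 0 (C n)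
  have hdn : ∀ n, ∀ x ∈ C n, d n ≤ ‖x‖ := fun n x hx => by
    simpa using Metric.infDist_le_dist_of_mem (x := (0 : X)) hx
  have hdB : ∀ n, d n ≤ B := fun n => by
    obtain ⟨x, hx⟩ := hne n
    exact (hdn n x hx).trans (hB x (hanti (Nat.zero_le n) hx))
  have hbdd : BddAbove (Set.range d) := ⟨B, by rintro _ ⟨n, rfl⟩; exact hdB n⟩
  set A := ⨆ n, d n
  have hdA : ∀ n, d n ≤ A := le_ciSup hbdd
  have hp : ∀ n : ℕ, ∃ p ∈ C n, ‖p‖ < d n + 1 / (n + 1) := fun n => by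
    obtain ⟨p, hp, h⟩ := (Metric.infDist_lt_iff (hne n)).1
      (show Metric.infDist 0 (C n) < d n + 1 / (n + 1 : ℝ) by
        have : (0 : ℝ) < 1 / (n + 1) := by positivity
        simp only [d]; linarith)
    exact ⟨p, hp, by simpa using h⟩
  choose p hpC hpd using hp
  have hdmono : Monotone d := fun m n hmn =>
    Metric.infDist_le_infDist_of_subset (hanti hmn) (hne n)
  have hcauchy : CauchySeq p := by
    rw [Metric.cauchySeq_iff']
    intro ε hε
    obtain ⟨η, hη, H⟩ := exists_pos_forall_norm_add_lt (X := X) A hε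
    obtain ⟨N₁, hN₁⟩ := exists_lt_of_lt_ciSup (show A - η < ⨆ n, d n by change A - η < A; linarith)
    obtain ⟨N₂, hN₂⟩ := exists_nat_one_div_lt hη
    have hbound : ∀ n ≥ max N₁ N₂, ‖p n‖ ≤ A + η := fun n hn => by
      have : (1 : ℝ) / (n + 1) ≤ 1 / (N₂ + 1) := by
        have : (N₂ : ℝ) ≤ n := by exact_mod_cast (le_max_right _ _).trans hn
        gcongr
      linarith [hpd n, hdA n]
    refine ⟨max N₁ N₂, fun n hn => ?_⟩
    by_contra! hcon
    rw [dist_eq_norm] at hcon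
    have h1 := H _ _ (hbound n hn) (hbound _ le_rfl) hcon
    have h2 : (1 / 2 : ℝ) • p n + (1 / 2 : ℝ) • p (max N₁ N₂) ∈ C (max N₁ N₂) :=
      hconv _ (hanti hn (hpC n)) (hpC _) (by norm_num) (by norm_num) (by norm_num)
    have h3 := hdn _ _ h2
    rw [← smul_add, norm_smul, Real.norm_of_nonneg (by norm_num)] at h3
    linarith [hdmono (le_max_left N₁ N₂)]
  obtain ⟨a, ha⟩ := cauchySeq_tendsto_of_complete hcauchy
  refine ⟨a, Set.mem_iInter.2 fun n => (hclosed n).mem_of_tendsto ha ?_⟩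
  filter_upwards [eventually_ge_atTop n] with m hm using hanti hm (hpC m)

variable {𝕜 : Type*} [RCLike 𝕜] {X : Type*} [NormedAddCommGroup X] [NormedSpace 𝕜 X]
  [NormedSpace ℝ X] [IsScalarTower ℝ 𝕜 X]

theorem convex_preimage_strongDual (f : StrongDual 𝕜 X) {s : Set 𝕜} (hs : Convex ℝ s) :
    Convex ℝ (f ⁻¹' s) :=
  hs.linear_preimage (f.toLinearMap.restrictScalars ℝ)

variable [UniformConvexSpace X] [CompleteSpace X]

theorem exists_norm_le_one_norm_le_re_apply (f : StrongDual 𝕜 X) :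
    ∃ x : X, ‖x‖ ≤ 1 ∧ ‖f‖ ≤ RCLike.re (f x) := by
  let s : ℕ → Set 𝕜 := fun n => {z | ‖f‖ - 1 / (n + 1) ≤ RCLike.re z}
  have hs : ∀ n, Convex ℝ (s n) := fun n =>
    (convex_Ici (𝕜 := ℝ) _).linear_preimage (RCLike.reLm (K := 𝕜))
  have hsc : ∀ n, IsClosed (s n) := fun n => isClosed_le continuous_const RCLike.continuous_re
  have hne := nonempty_iInter_of_antitone_convex
    (C := fun n => Metric.closedBall (0 : X) 1 ∩ f ⁻¹' s n) ?_ ?_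
    (fun n => Metric.isClosed_closedBall.inter ((hsc n).preimage f.continuous))
    (fun n => (convex_closedBall _ _).inter (convex_preimage_strongDual f (hs n)))
    (B := 1) (fun x hx => mem_closedBall_zero_iff.1 hx.1)
  · obtain ⟨x, hx⟩ := hne
    have hx1 : ‖x‖ ≤ 1 := mem_closedBall_zero_iff.1 (Set.mem_iInter.1 hx 0).1
    refine ⟨x, hx1, le_of_forall_pos_le_add fun ε hε => ?_⟩
    obtain ⟨n, hn⟩ := exists_nat_one_div_lt hε
    have : ‖f‖ - 1 / (n + 1) ≤ RCLike.re (f x) := (Set.mem_iInter.1 hx n).2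
    linarith
  · intro m n hmn x hx
    refine ⟨hx.1, ?_⟩
    have h2 : ‖f‖ - 1 / (n + 1) ≤ RCLike.re (f x) := hx.2
    have : (1 : ℝ) / (n + 1) ≤ 1 / (m + 1) := by
      have : (m : ℝ) ≤ n := by exact_mod_cast hmn
      gcongr
    change ‖f‖ - 1 / (m + 1) ≤ RCLike.re (f x)
    linarith
  · intro n
    have hlt : ‖f‖ - 1 / (n + 1) < ‖f‖ := by
      have : (0 : ℝ) < 1 / (n + 1) := by positivity
      linarith
    obtain ⟨x, hx, hx'⟩ := f.exists_lt_apply_of_lt_opNorm hlt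
    -- A unimodular factor makes the value of `f` real and nonnegative.
    obtain ⟨c, hc, hcf⟩ := RCLike.exists_norm_eq_mul_self (f x)
    refine ⟨c • x, ?_, ?_⟩
    · rw [mem_closedBall_zero_iff, norm_smul, hc, one_mul]; exact hx.le
    · change _ ≤ RCLike.re (f (c • x))
      rw [map_smul, smul_eq_mul, ← hcf, RCLike.ofReal_re]; exact hx'.le

/-- The closed span of the sequence is separable, so countably many functionals separate its points,
and a subsequence makes all of them converge. A common point of the closed convex hulls of the tails
takes, under any functional convergent along the sequence, the limit value. Every further
subsequence has such a point too, and separation makes all these points equal. -/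
theorem exists_weaklyConverges_subseq {x : ℕ → X} {B : ℝ} (hB : ∀ k, ‖x k‖ ≤ B) :
    ∃ (a : X) (φ : ℕ → ℕ), StrictMono φ ∧ WeaklyConverges 𝕜 (fun k => x (φ k)) a := by
  let Y : Submodule ℝ X := (Submodule.span ℝ (Set.range x)).topologicalClosure
  have hcl : ∀ φ : ℕ → ℕ, StrictMono φ → ∃ a ∈ Y, ∀ (f : StrongDual 𝕜 X) (α : 𝕜),
      Tendsto (fun k => f (x (φ k))) atTop (𝓝 α) → f a = α := by
    intro φ hφ
    obtain ⟨a, ha⟩ := nonempty_iInter_of_antitone_convex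
      (C := fun n => closure (convexHull ℝ ((fun k => x (φ k)) '' Set.Ici n)))
      (fun m n hmn => closure_mono (convexHull_mono (Set.image_mono (Set.Ici_subset_Ici.2 hmn))))
      (fun n => ⟨x (φ n), subset_closure (subset_convexHull ℝ _ ⟨n, Set.mem_Ici.2 le_rfl, rfl⟩)⟩)
      (fun n => isClosed_closure) (fun n => (convex_convexHull ℝ _).closure) (B := B) (by
        intro y hy
        have : closure (convexHull ℝ ((fun k => x (φ k)) '' Set.Ici 0)) ⊆
            Metric.closedBall 0 B := by
          refine closure_minimal (convexHull_min ?_ (convex_closedBall _ _))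
            Metric.isClosed_closedBall
          rintro _ ⟨k, -, rfl⟩
          exact mem_closedBall_zero_iff.2 (hB _)
        exact mem_closedBall_zero_iff.1 (this hy))
    refine ⟨a, ?_, fun f α hf => ?_⟩
    · refine closure_minimal (convexHull_min ?_ Y.convex)
        (Submodule.isClosed_topologicalClosure _) (Set.mem_iInter.1 ha 0)
      rintro _ ⟨k, -, rfl⟩
      exact Submodule.le_topologicalClosure _ (Submodule.subset_span ⟨_, rfl⟩)
    · refine eq_of_forall_dist_le fun ε hε => ?_
      obtain ⟨n, hn⟩ := eventually_atTop.1 ((Metric.tendsto_nhds.1 hf) ε hε)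
      have hsub : closure (convexHull ℝ ((fun k => x (φ k)) '' Set.Ici n)) ⊆
          f ⁻¹' Metric.closedBall α ε := by
        refine closure_minimal (convexHull_min ?_
          (convex_preimage_strongDual f (convex_closedBall _ _)))
          (Metric.isClosed_closedBall.preimage f.continuous)
        rintro _ ⟨k, hk, rfl⟩
        exact (hn k hk).le
      exact hsub (Set.mem_iInter.1 ha n)
  have hYsep : TopologicalSpace.IsSeparable (Y : Set X) :=
    ((Set.countable_range x).isSeparable.span (R := ℝ)).closure
  obtain ⟨c, hc, hcY⟩ := hYsep
  obtain ⟨y, hy⟩ := (hc.insert 0).exists_eq_range (Set.insert_nonempty 0 c)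
  choose F hF1 hF2 using fun n => exists_dual_vector'' 𝕜 (y n)
  have hsep : ∀ a ∈ Y, (∀ n, F n a = 0) → a = 0 := by
    intro a ha h
    by_contra hne
    have ha0 : 0 < ‖a‖ := norm_pos_iff.2 hne
    obtain ⟨b, hb, hab⟩ := Metric.mem_closure_iff.1 (hcY ha) (‖a‖ / 3) (by positivity)
    obtain ⟨n, rfl⟩ : b ∈ Set.range y := hy ▸ Set.mem_insert_of_mem _ hb
    have h1 : ‖F n (y n)‖ ≤ ‖y n - a‖ := by
      have := (F n).le_of_opNorm_le (hF1 n) (y n - a)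
      rwa [map_sub, h n, sub_zero, one_mul] at this
    rw [hF2, RCLike.norm_ofReal, abs_norm] at h1
    rw [dist_eq_norm] at hab
    rw [norm_sub_rev] at h1
    linarith [norm_sub_norm_le a (y n)]
  obtain ⟨ζ, -, φ, hφ, hζ⟩ := (isCompact_univ_pi fun n : ℕ =>
    isCompact_closedBall (0 : 𝕜) B).isSeqCompact (x := fun k n => F n (x k)) (fun k n _ => by
      have := (F n).le_of_opNorm_le (hF1 n) (x k)
      rw [one_mul] at this
      exact mem_closedBall_zero_iff.2 (this.trans (hB k)))
  have hζ' : ∀ n, Tendsto (fun k => F n (x (φ k))) atTop (𝓝 (ζ n)) :=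
    fun n => (tendsto_pi_nhds.1 hζ) n
  obtain ⟨a, haY, ha⟩ := hcl φ hφ
  refine ⟨a, φ, hφ, fun f => ?_⟩
  refine tendsto_of_subseq_tendsto fun ψ hψ => ?_
  obtain ⟨ψ', hψ', hψψ'⟩ := strictMono_subseq_of_tendsto_atTop hψ
  obtain ⟨α, -, χ, hχ, hα⟩ := (isCompact_closedBall (0 : 𝕜) (‖f‖ * B)).isSeqCompact
    (x := fun k => f (x (φ (ψ (ψ' k))))) (fun k => mem_closedBall_zero_iff.2
      ((f.le_opNorm _).trans (by gcongr; exact hB _)))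
  obtain ⟨b, hbY, hb⟩ := hcl (fun k => φ (ψ (ψ' (χ k)))) (hφ.comp (hψψ'.comp hχ))
  have hab : a - b = 0 := hsep _ (Y.sub_mem haY hbY) fun n => by
    rw [map_sub, ha _ _ (hζ' n), hb _ _ ((hζ' n).comp (hψψ'.comp hχ).tendsto_atTop), sub_self]
  refine ⟨fun k => ψ' (χ k), ?_⟩
  rw [sub_eq_zero.1 hab, hb f α hα]
  exact hα

end UniformlyConvex

/-! ### Uniform smoothness, property (*) and decoupling of gauges -/

section Isometries

variable {𝕜 : Type*} [RCLike 𝕜] {X : Type*} [NormedAddCommGroup X] [NormedSpace 𝕜 X]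

theorem LinearIsometryEquiv.inv_apply_self (g : X ≃ₗᵢ[𝕜] X) (x : X) : g⁻¹ (g x) = x :=
  g.symm_apply_apply x

theorem LinearIsometryEquiv.self_apply_inv (g : X ≃ₗᵢ[𝕜] X) (x : X) : g (g⁻¹ x) = x :=
  g.apply_symm_apply x

/-- Quantitative continuity of the duality map: evaluating `f` at `x + h` and `g` at `x - h`, with
`h` of length `η` in a direction where `f - g` is real and nonnegative, and adding, leaves `η * ‖(f
- g) z‖` below the defect allowed by smoothness plus the cost of moving `x` to `y`. -/
theorem norm_sub_le_of_smooth {ε η M : ℝ} (hη : 0 < η) (hM : 0 ≤ M)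
    (H : ∀ x y : X, ‖x‖ = 1 → ‖y‖ ≤ η → ‖x + y‖ + ‖x - y‖ ≤ 2 + ε * ‖y‖)
    {f g : StrongDual 𝕜 X} (hf : ‖f‖ ≤ M) (hg : ‖g‖ ≤ M) {x y : X} (hx : ‖x‖ = 1)
    (hfx : M ≤ RCLike.re (f x)) (hgy : M ≤ RCLike.re (g y)) (hε : 0 ≤ ε) :
    ‖f - g‖ ≤ M * (ε + ‖x - y‖ / η) := by
  refine ContinuousLinearMap.opNorm_le_of_unit_norm (by positivity) fun z hz => ?_
  obtain ⟨c, hc, hcz⟩ := RCLike.exists_norm_eq_mul_self ((f - g) z)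
  set h : X := ((η : 𝕜) * c) • z with hh
  have hhn : ‖h‖ = η := by
    rw [hh, norm_smul, norm_mul, hc, hz, RCLike.norm_ofReal, abs_of_pos hη]; ring
  have h1 : RCLike.re (f h) - RCLike.re (g h) = η * ‖(f - g) z‖ := by
    rw [← map_sub, ← sub_apply, hh, map_smul, smul_eq_mul, mul_assoc, ← hcz,
      RCLike.re_ofReal_mul, RCLike.ofReal_re]
  have hle : ∀ (F : StrongDual 𝕜 X), ‖F‖ ≤ M → ∀ u, RCLike.re (F u) ≤ M * ‖u‖ := fun F hF u =>
    (RCLike.re_le_norm _).trans (F.le_of_opNorm_le hF u)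
  have h2 := hle f hf (x + h)
  have h3 := hle g hg (x - h)
  have h4 := hle g hg (y - x)
  have h5 := mul_le_mul_of_nonneg_left (H x h hx hhn.le) hM
  simp only [map_add, map_sub] at h2 h3 h4
  rw [norm_sub_rev] at h4
  rw [hhn] at h5
  have h6 : η * ‖(f - g) z‖ ≤ M * (ε * η + ‖x - y‖) := by linarith
  have h7 : M * (ε + ‖x - y‖ / η) = M * (ε * η + ‖x - y‖) / η := by field_simp
  rw [h7, le_div_iff₀ hη]
  linarith

/-- Otherwise a subsequence of `g` converges strongly. Its limits vanish because `g ⇀ 0`, yet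
isometries preserve norms, so `X` is trivial. -/
theorem HasPropertyStar.opWeaklyNull_inv {D₀ : Subgroup (X ≃ₗᵢ[𝕜] X)}
    (hD₀ : HasPropertyStar D₀) {g : ℕ → X ≃ₗᵢ[𝕜] X} (hg : ∀ k, g k ∈ D₀)
    (h : OpWeaklyNull g) : OpWeaklyNull fun k => (g k)⁻¹ := by
  by_contra hcon
  obtain ⟨φ, hφ, h1, -⟩ := hD₀ _ (fun k => D₀.inv_mem (hg k)) hcon
  simp only [inv_inv] at h1
  have : ∀ x : X, x = 0 := fun x => by
    obtain ⟨y, hy⟩ := h1 x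
    have hy0 : y = 0 :=
      (WeaklyConverges.of_tendsto hy).unique ((h x).comp hφ.tendsto_atTop)
    have h3 := hy.norm
    simp only [LinearIsometryEquiv.norm_map, hy0, norm_zero] at h3
    exact norm_eq_zero.1 (tendsto_nhds_unique tendsto_const_nhds h3)
  refine hcon fun x => ?_
  simpa [this x] using WeaklyConverges.const (𝕜 := 𝕜) (0 : X)

variable [NormedSpace ℝ X] [IsScalarTower ℝ 𝕜 X] [UniformConvexSpace X] [CompleteSpace X]

/-- If `f` attains its norm at `x`, then `f ∘ T k` attains it at `(T k)⁻¹ x`. These points converge,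
and the duality map is uniformly continuous. -/
theorem IsUniformlySmooth.cauchySeq_comp (hX : IsUniformlySmooth X) {T : ℕ → X ≃ₗᵢ[𝕜] X}
    (hT : OpStronglyConvergent fun k => (T k)⁻¹) (f : StrongDual 𝕜 X) :
    CauchySeq fun k => f.comp (T k).toContinuousLinearEquiv.toContinuousLinearMap := by
  rcases eq_or_ne f 0 with rfl | hf0
  · simpa using cauchySeq_const (0 : StrongDual 𝕜 X)
  obtain ⟨x, hx, hfx⟩ := exists_norm_le_one_norm_le_re_apply f
  have hf : 0 < ‖f‖ := norm_pos_iff.2 hf0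
  have hx1 : ‖x‖ = 1 := by
    refine le_antisymm hx (le_of_mul_le_mul_left (a := ‖f‖) ?_ hf)
    rw [mul_one]
    exact hfx.trans ((RCLike.re_le_norm _).trans (f.le_opNorm x))
  obtain ⟨y, hy⟩ := hT x
  have hc := hy.cauchySeq
  have hn : ∀ k, ‖f.comp (T k).toContinuousLinearEquiv.toContinuousLinearMap‖ ≤ ‖f‖ := fun k =>
    ContinuousLinearMap.opNorm_le_bound _ hf.le fun z => by
      simpa using f.le_opNorm (T k z)
  have hre : ∀ k, ‖f‖ ≤ RCLike.re
      (f.comp (T k).toContinuousLinearEquiv.toContinuousLinearMap ((T k)⁻¹ x)) := fun k => by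
    change ‖f‖ ≤ RCLike.re (f (T k ((T k)⁻¹ x)))
    rwa [LinearIsometryEquiv.self_apply_inv]
  rw [Metric.cauchySeq_iff]
  intro ε hε
  obtain ⟨η, hη, H⟩ := hX (ε / (4 * ‖f‖)) (by positivity)
  obtain ⟨N, hN⟩ := Metric.cauchySeq_iff.1 hc (η * (ε / (4 * ‖f‖))) (by positivity)
  refine ⟨N, fun m hm n hn' => ?_⟩
  have h := norm_sub_le_of_smooth hη hf.le H (hn m) (hn n)
    (((T m)⁻¹.norm_map x).trans hx1) (hre m) (hre n) (by positivity)
  have h1 := hN m hm n hn'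
  rw [dist_eq_norm] at h1 ⊢
  have h2 : ‖(T m)⁻¹ x - (T n)⁻¹ x‖ / η ≤ ε / (4 * ‖f‖) := by
    rw [div_le_iff₀ hη]; linarith
  calc _ ≤ _ := h
    _ ≤ ‖f‖ * (ε / (4 * ‖f‖) + ε / (4 * ‖f‖)) := by gcongr
    _ = ε / 2 := by field_simp; norm_num
    _ < ε := by linarith

/-- Isometries whose inverses converge strongly preserve weak convergence to zero. -/
theorem IsUniformlySmooth.weaklyConverges_apply (hX : IsUniformlySmooth X)
    {T : ℕ → X ≃ₗᵢ[𝕜] X} (hT : OpStronglyConvergent fun k => (T k)⁻¹) {y : ℕ → X} {B : ℝ}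
    (hB : ∀ k, ‖y k‖ ≤ B) (hy : WeaklyConverges 𝕜 y 0) :
    WeaklyConverges 𝕜 (fun k => T k (y k)) 0 := by
  intro f
  obtain ⟨F, hF⟩ := cauchySeq_tendsto_of_complete (hX.cauchySeq_comp hT f)
  rw [map_zero]
  have h1 := hy F
  rw [map_zero] at h1
  have h2 : Tendsto (fun k => (f.comp (T k).toContinuousLinearEquiv.toContinuousLinearMap - F)
      (y k)) atTop (𝓝 0) := by
    refine squeeze_zero_norm (a := fun k =>
      ‖f.comp (T k).toContinuousLinearEquiv.toContinuousLinearMap - F‖ * B) (fun k => ?_) ?_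
    · exact (ContinuousLinearMap.le_opNorm _ _).trans (by gcongr; exact hB k)
    · simpa using (tendsto_iff_norm_sub_tendsto_zero.1 hF).mul_const B
  simpa using h2.add h1

/-- If `h⁻¹ g` were not weakly null, it would converge strongly along a subsequence. Its inverse
`g⁻¹ h` would then preserve weak nullity and carry `h⁻¹ v ⇀ 0` to `g⁻¹ v ⇀ 0`, against `w ≠ 0`. -/
theorem HasPropertyStar.opWeaklyNull (hX : IsUniformlySmooth X) {D₀ : Subgroup (X ≃ₗᵢ[𝕜] X)}
    (hD₀ : HasPropertyStar D₀) {g h : ℕ → X ≃ₗᵢ[𝕜] X} (hg : ∀ k, g k ∈ D₀) (hh : ∀ k, h k ∈ D₀)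
    {v : ℕ → X} {B : ℝ} (hB : ∀ k, ‖v k‖ ≤ B) {w : X} (hw : w ≠ 0)
    (hhv : WeaklyConverges 𝕜 (fun k => (h k)⁻¹ (v k)) 0)
    (hgv : WeaklyConverges 𝕜 (fun k => (g k)⁻¹ (v k)) w) :
    OpWeaklyNull fun k => (h k)⁻¹ * g k := by
  by_contra hcon
  obtain ⟨φ, hφ, -, h2⟩ := hD₀ _ (fun k => D₀.mul_mem (D₀.inv_mem (hh k)) (hg k)) hcon
  have h3 := hX.weaklyConverges_apply (T := fun j => ((h (φ j))⁻¹ * g (φ j))⁻¹)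
    (by simpa only [inv_inv] using h2) (y := fun j => (h (φ j))⁻¹ (v (φ j))) (B := B)
    (fun j => by rw [LinearIsometryEquiv.norm_map]; exact hB _) (hhv.comp hφ.tendsto_atTop)
  refine hw ((hgv.comp hφ.tendsto_atTop).unique (h3.congr (Eventually.of_forall fun j => ?_)))
  change ((h (φ j))⁻¹ * g (φ j))⁻¹ ((h (φ j))⁻¹ (v (φ j))) = (g (φ j))⁻¹ (v (φ j))
  rw [mul_inv_rev, inv_inv]
  change (g (φ j))⁻¹ (h (φ j) ((h (φ j))⁻¹ (v (φ j)))) = _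
  rw [LinearIsometryEquiv.self_apply_inv]

end Isometries

/-! ### Energy bound for arbitrary profile decompositions -/

section Energy

variable {𝕜 : Type*} [RCLike 𝕜] {X : Type*} [NormedAddCommGroup X] [NormedSpace 𝕜 X]

/-- The point `a / 2` is tested twice in Opial's condition. The first test gives only a definite gap
`‖x k - a‖ ≤ t - η / 2`. This gap leaves room to move `x k` and `x k - a` by one common small vector
into the `t`-ball, so that their difference is exactly `a` and no continuity of the modulus is
needed. -/
theorem SatisfiesOpial.eventually_norm_sub_le_sub_modulusOfConvexity [NormedSpace ℝ X]
    [UniformConvexSpace X] (hO : SatisfiesOpial 𝕜 X) {x : ℕ → X} {a : X}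
    (hx : WeaklyConverges 𝕜 x a) {t : ℝ} (ht : t ≤ 1)
    (hxt : ∀ ε > 0, ∀ᶠ k in atTop, ‖x k‖ ≤ t + ε) {ε : ℝ} (hε : 0 < ε) :
    ∀ᶠ k in atTop, ‖x k - a‖ ≤ t - modulusOfConvexity X ‖a‖ + ε := by
  have ht0 : 0 ≤ t := by
    refine le_of_forall_pos_le_add fun ε hε => ?_
    obtain ⟨k, hk⟩ := (hxt ε hε).exists
    exact (norm_nonneg _).trans hk
  have h0 : ∀ ε > 0, ∀ᶠ k in atTop, ‖x k - a‖ ≤ t + ε := fun ε hε => by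
    have := hO.eventually_norm_sub_le hx 0 (s := t + ε / 2)
      ((hxt (ε / 2) (half_pos hε)).mono fun k hk => by simpa using hk) (half_pos hε)
    exact this.mono fun k hk => by linarith
  rcases eq_or_ne a 0 with rfl | ha
  · rw [norm_zero, modulusOfConvexity_zero, sub_zero]; exact h0 ε hε
  obtain ⟨η, hη, H⟩ := exists_pos_forall_norm_add_lt (X := X) t (norm_pos_iff.2 ha)
  have hmid : ∀ k, x k - (2⁻¹ : ℝ) • a = (2⁻¹ : ℝ) • (x k + (x k - a)) := fun k => by
    rw [smul_add, smul_sub, ← add_sub_assoc, ← add_smul]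
    norm_num
  have hmidn : ∀ k, ‖x k - (2⁻¹ : ℝ) • a‖ = ‖x k + (x k - a)‖ / 2 := fun k => by
    rw [hmid, norm_smul, Real.norm_of_nonneg (by norm_num)]; ring
  have h1 : ∀ᶠ k in atTop, ‖x k - (2⁻¹ : ℝ) • a‖ ≤ t - η := by
    filter_upwards [hxt η hη, h0 η hη] with k h1 h2
    rw [hmidn]
    linarith [H _ _ h1 h2 (by rw [sub_sub_cancel])]
  have h2 := hO.eventually_norm_sub_le hx _ h1 (half_pos hη)
  set e := min (η / 2) (ε / 2) with he
  have he0 : 0 < e := by positivity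
  have h3 : ∀ᶠ k in atTop, ‖x k - (2⁻¹ : ℝ) • a‖ ≤ t - modulusOfConvexity X ‖a‖ + e := by
    filter_upwards [hxt e he0, h2] with k h1 h2
    -- This value satisfies `(1 - c) * (t + e) = t`, so subtracting `c • x k` brings `x k` into the
    -- `t`-ball at a cost of at most `e`.
    set c := e / (t + e) with hc
    have hc0 : 0 ≤ c := by positivity
    have hc1 : c * (t + e) = e := by rw [hc]; field_simp
    have hz : ‖c • x k‖ ≤ e := by
      rw [norm_smul, Real.norm_of_nonneg hc0, ← hc1]
      gcongr
    have hx' : ‖x k - c • x k‖ ≤ t := by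
      have hc2 : 0 ≤ 1 - c := by
        rw [hc, sub_nonneg, div_le_one (by linarith)]; linarith
      rw [show x k - c • x k = (1 - c) • x k by rw [sub_smul, one_smul], norm_smul,
        Real.norm_of_nonneg hc2]
      calc (1 - c) * ‖x k‖ ≤ (1 - c) * (t + e) := by gcongr
        _ = t := by linarith
    have hy' : ‖x k - a - c • x k‖ ≤ t :=
      (norm_sub_le _ _).trans (by linarith [min_le_left (η / 2) (ε / 2)])
    have h4 := norm_add_div_two_le_sub_modulusOfConvexity ht hx' hy'
    rw [show x k - c • x k - (x k - a - c • x k) = a by abel] at h4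
    rw [hmidn]
    have h5 : ‖x k + (x k - a)‖ ≤ ‖x k - c • x k + (x k - a - c • x k)‖ + ‖c • x k‖ + ‖c • x k‖ := by
      calc ‖x k + (x k - a)‖ = ‖x k - c • x k + (x k - a - c • x k) + c • x k + c • x k‖ := by
            congr 1; abel
        _ ≤ _ := norm_add₃_le
    linarith
  filter_upwards [hO.eventually_norm_sub_le hx _ h3 (half_pos hε)] with k hk
  linarith [min_le_right (η / 2) (ε / 2)]

variable {D : Set (X ≃ₗᵢ[𝕜] X)} {u : ℕ → X} {S : Set ℕ} {g : ℕ → ℕ → X ≃ₗᵢ[𝕜] X} {w : ℕ → X}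
  {r : ℕ → X}

namespace IsProfileDecomposition

theorem exists_finset_norm_sub_le (h : IsProfileDecomposition D u S g w r) {ε : ℝ} (hε : 0 < ε) :
    ∃ F₀ : Finset ℕ, ∀ F, F₀ ⊆ F → ∀ k, ‖∑' n, g n k (w n) - ∑ n ∈ F, g n k (w n)‖ ≤ ε := by
  obtain ⟨F₀, hF₀⟩ := eventually_atTop.1 (Metric.tendstoUniformly_iff.1 h.tendstoUniformly ε hε)
  exact ⟨F₀, fun F hF k => by rw [← dist_eq_norm]; exact (hF₀ F hF k).le⟩

theorem weaklyConverges (h : IsProfileDecomposition D u S g w r) {m : ℕ} (hm : m ∈ S)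
    {F : Finset ℕ} (hmF : m ∉ F) :
    WeaklyConverges 𝕜 (fun k => (g m k)⁻¹ (u k - ∑ n ∈ F, g n k (w n))) (w m) := by
  refine WeaklyConverges.of_approx fun ε hε => ?_
  -- Uniform convergence replaces the series by a finite sum, where decoupling kills every term but
  -- the one of index `m`.
  obtain ⟨F₀, hF₀⟩ := h.exists_finset_norm_sub_le hε
  set F₁ := F₀ ∪ F ∪ {m} with hF₁
  refine ⟨fun k => ∑ n ∈ F₁ \ F, (g m k)⁻¹ (g n k (w n)) + (g m k)⁻¹ (r k), ?_, ?_⟩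
  · have h1 : WeaklyConverges 𝕜 (fun k => ∑ n ∈ F₁ \ F, (g m k)⁻¹ (g n k (w n)))
        (∑ n ∈ F₁ \ F, if n = m then w m else 0) := by
      refine WeaklyConverges.sum fun n _ => ?_
      split_ifs with hnm
      · subst hnm
        exact (WeaklyConverges.const (w n)).congr
          (Eventually.of_forall fun k => ((g n k).inv_apply_self _).symm)
      · by_cases hn : n ∈ S
        · exact h.decoupled m hm n hn hnm (w n)
        · simpa [h.profile_eq_zero n hn] using WeaklyConverges.const (𝕜 := 𝕜) (0 : X)
    have h2 := h1.add (h.remainder (g m) (h.gauge_mem m))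
    rwa [Finset.sum_ite_eq', if_pos (by simp [hF₁, hmF]), add_zero] at h2
  · refine Eventually.of_forall fun k => ?_
    have hsub : F ⊆ F₁ := fun n hn => by simp [hF₁, hn]
    beta_reduce
    rw [← map_sum, ← map_add, ← map_sub, LinearIsometryEquiv.norm_map, h.eq_sum_add k]
    have h3 := hF₀ F₁ (fun n hn => by simp [hF₁, hn]) k
    rw [← Finset.sum_sdiff hsub] at h3
    refine le_trans (le_of_eq ?_) h3
    congr 1
    abel

theorem eventually_norm_sub_sum_le [NormedSpace ℝ X] [UniformConvexSpace X]
    (hO : SatisfiesOpial 𝕜 X) (h : IsProfileDecomposition D u S g w r) (hu : ∀ k, ‖u k‖ ≤ 1)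
    (F : Finset ℕ) : ∀ ε > 0, ∀ᶠ k in atTop, ‖u k - ∑ n ∈ F, g n k (w n)‖ ≤
      1 - ∑ n ∈ F, modulusOfConvexity X ‖w n‖ + ε := by
  induction F using Finset.induction_on with
  | empty =>
    intro ε hε
    refine Eventually.of_forall fun k => ?_
    simpa using (hu k).trans (by linarith)
  | insert m F hmF ih =>
    intro ε hε
    rw [Finset.sum_insert hmF]
    simp only [Finset.sum_insert hmF]
    by_cases hm : m ∈ S
    · have hle : 1 - ∑ n ∈ F, modulusOfConvexity X ‖w n‖ ≤ 1 := by
        linarith [Finset.sum_nonneg fun n (_ : n ∈ F) => modulusOfConvexity_nonneg X ‖w n‖]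
      have := hO.eventually_norm_sub_le_sub_modulusOfConvexity (h.weaklyConverges hm hmF) hle
        (fun ε hε => by simpa only [LinearIsometryEquiv.norm_map] using ih ε hε) hε
      filter_upwards [this] with k hk
      rw [← (g m k).norm_map, map_sub, LinearIsometryEquiv.self_apply_inv] at hk
      rw [add_comm (g m k (w m)), ← sub_sub]
      linarith
    · simpa [h.profile_eq_zero m hm, modulusOfConvexity_zero] using ih ε hε

theorem norm_profile_le (h : IsProfileDecomposition D u S g w r) {C : ℝ} (hC : 0 ≤ C)
    (hu : ∀ k, ‖u k‖ ≤ C) (n : ℕ) : ‖w n‖ ≤ C := by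
  by_cases hn : n ∈ S
  · refine (h.weaklyConverges hn (Finset.notMem_empty n)).norm_le
      (Eventually.frequently (Eventually.of_forall fun k => ?_))
    simpa [LinearIsometryEquiv.norm_map] using hu k
  · simpa [h.profile_eq_zero n hn] using hC

theorem limsup_add_tsum_le [NormedSpace ℝ X] [UniformConvexSpace X]
    (hO : SatisfiesOpial 𝕜 X) (h : IsProfileDecomposition D u S g w r) (hu : ∀ k, ‖u k‖ ≤ 1) :
    limsup (fun k => ‖r k‖ₑ) atTop
      + ∑' n, ENNReal.ofReal (modulusOfConvexity X ‖w n‖) ≤ 1 := by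
  have key : ∀ F : Finset ℕ, ∀ ε > 0, ∀ᶠ k in atTop,
      ‖r k‖ ≤ 1 - ∑ n ∈ F, modulusOfConvexity X ‖w n‖ + ε := fun F ε hε => by
    -- Enlarging `F` by `F₀` makes `r k` uniformly close to a finite remainder and only strengthens
    -- the bound, the modulus being nonnegative.
    obtain ⟨F₀, hF₀⟩ := h.exists_finset_norm_sub_le (half_pos hε)
    filter_upwards [h.eventually_norm_sub_sum_le hO hu (F₀ ∪ F) _ (half_pos hε)] with k hk
    have h1 := hF₀ (F₀ ∪ F) Finset.subset_union_left k
    have h2 : r k = (u k - ∑ n ∈ F₀ ∪ F, g n k (w n)) -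
        (∑' n, g n k (w n) - ∑ n ∈ F₀ ∪ F, g n k (w n)) := by rw [h.eq_sum_add k]; abel
    have h3 := norm_sub_le (u k - ∑ n ∈ F₀ ∪ F, g n k (w n))
      (∑' n, g n k (w n) - ∑ n ∈ F₀ ∪ F, g n k (w n))
    rw [← h2] at h3
    have h4 : ∑ n ∈ F, modulusOfConvexity X ‖w n‖ ≤ ∑ n ∈ F₀ ∪ F, modulusOfConvexity X ‖w n‖ :=
      Finset.sum_le_sum_of_subset_of_nonneg Finset.subset_union_right
        fun n _ _ => modulusOfConvexity_nonneg X _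
    linarith
  rw [ENNReal.tsum_eq_iSup_sum, ENNReal.add_iSup]
  refine iSup_le fun F => ENNReal.le_of_forall_pos_le_add fun ε hε _ => ?_
  have hε' : (0 : ℝ) < ε := hε
  have hδ : 0 ≤ ∑ n ∈ F, modulusOfConvexity X ‖w n‖ :=
    Finset.sum_nonneg fun n _ => modulusOfConvexity_nonneg X _
  have hpos : 0 ≤ 1 - ∑ n ∈ F, modulusOfConvexity X ‖w n‖ + ε := by
    obtain ⟨k, hk⟩ := (key F ε hε').exists
    exact (norm_nonneg _).trans hk
  have h1 : limsup (fun k => ‖r k‖ₑ) atTop ≤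
      ENNReal.ofReal (1 - ∑ n ∈ F, modulusOfConvexity X ‖w n‖ + ε) := by
    refine limsup_le_of_le (by isBoundedDefault) ?_
    filter_upwards [key F ε hε'] with k hk
    rw [← ofReal_norm]
    exact ENNReal.ofReal_le_ofReal hk
  rw [← ENNReal.ofReal_sum_of_nonneg fun n _ => modulusOfConvexity_nonneg X _]
  calc _ ≤ _ := add_le_add_left h1 _
    _ = ENNReal.ofReal (1 + ε) := by rw [← ENNReal.ofReal_add hpos hδ]; congr 1; ring
    _ = 1 + ε := by
      rw [ENNReal.ofReal_add zero_le_one hε'.le, ENNReal.ofReal_one, ENNReal.ofReal_coe_nnreal]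

end IsProfileDecomposition

end Energy

/-! ### Greedy extraction of profiles along a diagonal subsequence -/

section Extraction

variable {𝕜 : Type*} [RCLike 𝕜] {X : Type*} [NormedAddCommGroup X] [NormedSpace 𝕜 X]

/-- `w` is the weak limit of `(g k)⁻¹ (v (θ k))` for some gauges `g k ∈ D` and some `θ` tending to
infinity. -/
def IsDWeakCluster (D : Set (X ≃ₗᵢ[𝕜] X)) (v : ℕ → X) (w : X) : Prop :=
  ∃ θ : ℕ → ℕ, Tendsto θ atTop atTop ∧ ∃ g : ℕ → X ≃ₗᵢ[𝕜] X, (∀ k, g k ∈ D) ∧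
    WeaklyConverges 𝕜 (fun k => (g k)⁻¹ (v (θ k))) w

theorem IsDWeakCluster.of_eventuallyEq_comp {D : Set (X ≃ₗᵢ[𝕜] X)} {v v' : ℕ → X} {w : X}
    (h : IsDWeakCluster D v w) {θ : ℕ → ℕ} (hθ : Tendsto θ atTop atTop)
    (hv : v =ᶠ[atTop] fun k => v' (θ k)) : IsDWeakCluster D v' w := by
  obtain ⟨θ', hθ', g, hg, hw⟩ := h
  refine ⟨fun k => θ (θ' k), hθ.comp hθ', g, hg, hw.congr ?_⟩
  filter_upwards [hθ'.eventually hv] with k hk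
  rw [hk]

theorem IsDWeakCluster.norm_le {D : Set (X ≃ₗᵢ[𝕜] X)} {v : ℕ → X} {w : X} {B : ℝ}
    (h : IsDWeakCluster D v w) (hB : ∀ k, ‖v k‖ ≤ B) : ‖w‖ ≤ B := by
  obtain ⟨θ, -, g, -, hw⟩ := h
  exact hw.norm_le (Eventually.frequently (Eventually.of_forall fun k => by
    rw [LinearIsometryEquiv.norm_map]; exact hB _))

/-- Successive extraction of concentration profiles: `W n` is the weak limit of the `n`-th
remainder in the gauge `G n`, and no weak cluster point of that remainder with respect to the
gauges in `E n` exceeds `2 ‖W n‖`. -/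
structure IsGreedyExtraction (E : ℕ → Set (X ≃ₗᵢ[𝕜] X)) (u : ℕ → X)
    (G : ℕ → ℕ → X ≃ₗᵢ[𝕜] X) (W : ℕ → X) : Prop where
  gauge_mem : ∀ n k, G n k ∈ E n
  weaklyConverges : ∀ n, WeaklyConverges 𝕜
    (fun k => (G n k)⁻¹ (u k - ∑ i ∈ Finset.range n, G i k (W i))) (W n)
  norm_le : ∀ n w, IsDWeakCluster (E n) (fun k => u k - ∑ i ∈ Finset.range n, G i k (W i)) w →
    ‖w‖ ≤ 2 * ‖W n‖

namespace IsGreedyExtraction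

variable {E : ℕ → Set (X ≃ₗᵢ[𝕜] X)} {u : ℕ → X} {G : ℕ → ℕ → X ≃ₗᵢ[𝕜] X} {W : ℕ → X}

theorem comp (h : IsGreedyExtraction E u G W) {θ : ℕ → ℕ} (hθ : Tendsto θ atTop atTop) :
    IsGreedyExtraction E (fun k => u (θ k)) (fun n k => G n (θ k)) W where
  gauge_mem n _ := h.gauge_mem n _
  weaklyConverges n := (h.weaklyConverges n).comp hθ
  norm_le n w hw := h.norm_le n w (hw.of_eventuallyEq_comp hθ EventuallyEq.rfl)

theorem congr_gauge (h : IsGreedyExtraction E u G W) {G' : ℕ → ℕ → X ≃ₗᵢ[𝕜] X}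
    (hG' : ∀ n k, G' n k ∈ E n) (hGG' : ∀ n, G n =ᶠ[atTop] G' n) :
    IsGreedyExtraction E u G' W := by
  have hsum : ∀ n, (fun k => u k - ∑ i ∈ Finset.range n, G i k (W i)) =ᶠ[atTop]
      fun k => u k - ∑ i ∈ Finset.range n, G' i k (W i) := fun n => by
    have : ∀ᶠ k in atTop, ∀ i ∈ Finset.range n, G i k = G' i k :=
      (Finset.eventually_all _).2 fun i _ => hGG' i
    filter_upwards [this] with k hk
    rw [Finset.sum_congr rfl fun i hi => by rw [hk i hi]]
  refine ⟨hG', fun n => (h.weaklyConverges n).congr ?_, fun n w hw => h.norm_le n w ?_⟩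
  · filter_upwards [hGG' n, hsum n] with k h1 h2
    rw [h1, h2]
  · exact hw.of_eventuallyEq_comp tendsto_id (hsum n).symm

end IsGreedyExtraction

/-- The composition `ψ n ∘ ψ (n + 1) ∘ ⋯ ∘ ψ (n + l - 1)`. -/
def iterComp (ψ : ℕ → ℕ → ℕ) : ℕ → ℕ → ℕ → ℕ
  | _, 0, k => k
  | n, l + 1, k => ψ n (iterComp ψ (n + 1) l k)

theorem iterComp_succ (ψ : ℕ → ℕ → ℕ) (n l k : ℕ) :
    iterComp ψ n (l + 1) k = iterComp ψ n l (ψ (n + l) k) := by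
  induction l generalizing n with
  | zero => rfl
  | succ l ih =>
    rw [iterComp, ih, iterComp, show n + 1 + l = n + (l + 1) by omega]

theorem strictMono_iterComp {ψ : ℕ → ℕ → ℕ} (hψ : ∀ n, StrictMono (ψ n)) (n l : ℕ) :
    StrictMono (iterComp ψ n l) := by
  induction l generalizing n with
  | zero => exact strictMono_id
  | succ l ih => exact (hψ n).comp (ih (n + 1))

variable [NormedSpace ℝ X] [IsScalarTower ℝ 𝕜 X] [UniformConvexSpace X] [CompleteSpace X]

theorem exists_greedy_step {D : Set (X ≃ₗᵢ[𝕜] X)} (hD : 1 ∈ D) {v : ℕ → X} {B : ℝ}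
    (hB : ∀ k, ‖v k‖ ≤ B) :
    ∃ (ψ : ℕ → ℕ) (g : ℕ → X ≃ₗᵢ[𝕜] X) (w : X), StrictMono ψ ∧ (∀ k, g k ∈ D) ∧
      WeaklyConverges 𝕜 (fun k => (g k)⁻¹ (v (ψ k))) w ∧
      ∀ w', IsDWeakCluster D v w' → ‖w'‖ ≤ 2 * ‖w‖ := by
  obtain ⟨w, hw, hmax⟩ : ∃ w, IsDWeakCluster D v w ∧
      ∀ w', IsDWeakCluster D v w' → ‖w'‖ ≤ 2 * ‖w‖ := by
    set N : Set ℝ := {t | ∃ w, IsDWeakCluster D v w ∧ ‖w‖ = t} with hN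
    obtain ⟨a, φ, hφ, ha⟩ := exists_weaklyConverges_subseq (𝕜 := 𝕜) hB
    have haD : IsDWeakCluster D v a := ⟨φ, hφ.tendsto_atTop, fun _ => 1, fun _ => hD, by simpa⟩
    have hne : N.Nonempty := ⟨_, a, haD, rfl⟩
    have hbdd : BddAbove N := ⟨B, by rintro _ ⟨w, hw, rfl⟩; exact hw.norm_le hB⟩
    have hle : ∀ w, IsDWeakCluster D v w → ‖w‖ ≤ sSup N := fun w hw =>
      le_csSup hbdd ⟨w, hw, rfl⟩
    rcases le_or_gt (sSup N) 0 with h0 | h0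
    -- Here every cluster point is zero, so any of them will do.
    · exact ⟨a, haD, fun w' hw' => by linarith [hle w' hw', norm_nonneg a]⟩
    · obtain ⟨_, ⟨w, hw, rfl⟩, hlt⟩ := exists_lt_of_lt_csSup hne (half_lt_self h0)
      exact ⟨w, hw, fun w' hw' => by linarith [hle w' hw']⟩
  obtain ⟨θ, hθ, g, hg, hgw⟩ := hw
  obtain ⟨ρ, hρ, hθρ⟩ := strictMono_subseq_of_tendsto_atTop hθ
  exact ⟨θ ∘ ρ, g ∘ ρ, w, hθρ, fun k => hg _, hgw.comp hρ.tendsto_atTop, hmax⟩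

theorem exists_isGreedyExtraction {E : ℕ → Set (X ≃ₗᵢ[𝕜] X)} (hE : ∀ n, 1 ∈ E n) {u : ℕ → X}
    {B : ℝ} (hB : ∀ k, ‖u k‖ ≤ B) :
    ∃ (φ : ℕ → ℕ) (G : ℕ → ℕ → X ≃ₗᵢ[𝕜] X) (W : ℕ → X), StrictMono φ ∧
      IsGreedyExtraction E (fun k => u (φ k)) G W := by
  have hstep : ∀ (n : ℕ) (v : {v : ℕ → X // ∃ B : ℝ, ∀ k, ‖v k‖ ≤ B}),
      ∃ (ψ : ℕ → ℕ) (g : ℕ → X ≃ₗᵢ[𝕜] X) (w : X), StrictMono ψ ∧ (∀ k, g k ∈ E n) ∧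
      WeaklyConverges 𝕜 (fun k => (g k)⁻¹ (v.1 (ψ k))) w ∧
      ∀ w', IsDWeakCluster (E n) v.1 w' → ‖w'‖ ≤ 2 * ‖w‖ := fun n v =>
    exists_greedy_step (hE n) v.2.choose_spec
  choose ψ' g' w' hψ' hg' hw' hmax' using hstep
  let v : ℕ → {v : ℕ → X // ∃ B : ℝ, ∀ k, ‖v k‖ ≤ B} := fun n => Nat.rec ⟨u, B, hB⟩
    (fun n v => ⟨fun k => v.1 (ψ' n v k) - g' n v k (w' n v), by
      obtain ⟨B, hB⟩ := v.2
      refine ⟨B + ‖w' n v‖, fun k => (norm_sub_le _ _).trans ?_⟩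
      rw [LinearIsometryEquiv.norm_map]
      linarith [hB (ψ' n v k)]⟩) n
  set ψ : ℕ → ℕ → ℕ := fun n => ψ' n (v n) with hψ
  have hψm : ∀ n, StrictMono (ψ n) := fun n => hψ' n (v n)
  set g : ℕ → ℕ → X ≃ₗᵢ[𝕜] X := fun n => g' n (v n) with hg
  set W : ℕ → X := fun n => w' n (v n) with hW
  have hv : ∀ n k, (v (n + 1)).1 k = (v n).1 (ψ n k) - g n k (W n) := fun n k => rfl
  -- For `k ≥ n`, this is the index, within the sequence of stage `n`, of the `k`-th diagonal term.
  -- For `k < n` truncated subtraction gives `θ n k = k`, which is harmless since only large `k`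
  -- matter.
  set θ : ℕ → ℕ → ℕ := fun n k => iterComp ψ n (k - n) k with hθ
  have hθt : ∀ n, Tendsto (θ n) atTop atTop := fun n =>
    tendsto_atTop_mono (fun k => (strictMono_iterComp hψm n (k - n)).le_apply) tendsto_id
  have hθs : ∀ n k, n + 1 ≤ k → θ n k = ψ n (θ (n + 1) k) := fun n k hk => by
    simp only [hθ]
    rw [show k - n = (k - (n + 1)) + 1 by omega]
    rfl
  set G : ℕ → ℕ → X ≃ₗᵢ[𝕜] X := fun n k => g n (θ (n + 1) k) with hG
  have hV : ∀ n k, n ≤ k →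
      u (θ 0 k) - ∑ i ∈ Finset.range n, G i k (W i) = (v n).1 (θ n k) := by
    intro n
    induction n with
    | zero => intro k _; simp [v]
    | succ n ih =>
      intro k hk
      rw [Finset.sum_range_succ, ← sub_sub, ih k (by omega), hv, hθs n k hk]
  refine ⟨θ 0, G, W, strictMono_nat_of_lt_succ fun k => ?_, fun n k => hg' n (v n) _, fun n => ?_,
    fun n w hw => hmax' n (v n) w (hw.of_eventuallyEq_comp (hθt n) ?_)⟩
  · simp only [hθ, Nat.sub_zero]
    rw [iterComp_succ]
    exact strictMono_iterComp hψm 0 k (Nat.lt_of_lt_of_le k.lt_succ_self (hψm _).le_apply)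
  · refine ((hw' n (v n)).comp (hθt (n + 1))).congr ?_
    filter_upwards [eventually_ge_atTop (n + 1)] with k hk
    rw [hV n k (by omega), hθs n k hk]
  · filter_upwards [eventually_ge_atTop n] with k hk using hV n k hk

end Extraction

/-! ### From eventually small tails to uniformly small tails -/

section UniformTails

variable {X : Type*} [NormedAddCommGroup X]

/-- The smallness in the hypothesis starts at a `k` depending on `F`. The indices are cut into
blocks whose partial sums are eventually at most `2⁻ⁱ`. A block has finitely many subsets, hence one
threshold, used as `K n` throughout the block. A sum over part of a block is then evaluated at a
single time past its threshold, and the blocks add up geometrically. -/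
theorem exists_shift_forall_norm_sum_le {c : ℕ → ℕ → X}
    (hc : ∀ ε > 0, ∃ N, ∀ F : Finset ℕ, (∀ n ∈ F, N ≤ n) →
      ∀ᶠ k in atTop, ‖∑ n ∈ F, c n k‖ ≤ ε) :
    ∃ K : ℕ → ℕ, ∀ ε > 0, ∃ N, ∀ F : Finset ℕ, (∀ n ∈ F, N ≤ n) →
      ∀ k, ‖∑ n ∈ F, c n (max k (K n))‖ ≤ ε := by
  choose N hN using fun i : ℕ => hc ((1 / 2 : ℝ) ^ i) (by positivity)
  obtain ⟨M, hM, hNM⟩ : ∃ M : ℕ → ℕ, StrictMono M ∧ ∀ i, N i ≤ M i := by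
    refine ⟨fun i => ∑ j ∈ Finset.range (i + 1), (N j + 1), strictMono_nat_of_lt_succ fun i => ?_,
      fun i => ?_⟩
    · rw [Finset.sum_range_succ _ (i + 1)]; omega
    · beta_reduce; rw [Finset.sum_range_succ]; omega
  have hblock : ∀ i, ∃ K, ∀ k ≥ K, ∀ F ∈ (Finset.Ico (M i) (M (i + 1))).powerset,
      ‖∑ n ∈ F, c n k‖ ≤ (1 / 2 : ℝ) ^ i := fun i => by
    refine eventually_atTop.1 ((Finset.eventually_all _).2 fun F hF => hN i F fun n hn => ?_)
    exact (hNM i).trans (Finset.mem_Ico.1 (Finset.mem_powerset.1 hF hn)).1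
  choose K hK using hblock
  have hb : ∀ n, ∃ i, n < M (i + 1) := fun n =>
    ⟨n, lt_of_lt_of_le (Nat.lt_succ_self n) hM.le_apply⟩
  have hbi : ∀ i n, M i ≤ n → n < M (i + 1) → Nat.find (hb n) = i := fun i n h1 h2 => by
    rw [Nat.find_eq_iff]
    exact ⟨h2, fun j hj => not_lt.2 ((hM.monotone (Nat.succ_le_of_lt hj)).trans h1)⟩
  refine ⟨fun n => K (Nat.find (hb n)), fun ε hε => ?_⟩
  have key : ∀ i L k : ℕ, ∀ F : Finset ℕ, (∀ n ∈ F, M i ≤ n) → (∀ n ∈ F, n < M (i + L)) →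
      ‖∑ n ∈ F, c n (max k (K (Nat.find (hb n))))‖ ≤
        2 * (1 / 2 : ℝ) ^ i - 2 * (1 / 2 : ℝ) ^ (i + L) := by
    intro i L k
    induction L with
    | zero =>
      intro F h1 h2
      rw [Finset.eq_empty_of_forall_notMem fun n hn => absurd (h1 n hn) (not_le.2 (h2 n hn))]
      simp
    | succ L ih =>
      intro F h1 h2
      let F₁ : Finset ℕ := F.filter fun n : ℕ => n < M (i + L)
      let F₂ : Finset ℕ := F.filter fun n : ℕ => ¬ n < M (i + L)
      have h3 := ih F₁ (fun n hn => h1 n (Finset.mem_filter.1 hn).1)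
        (fun n hn => (Finset.mem_filter.1 hn).2)
      have h4 : ∀ n ∈ F₂, M (i + L) ≤ n ∧ n < M (i + L + 1) := fun n hn =>
        ⟨not_lt.1 (Finset.mem_filter.1 hn).2, h2 n (Finset.mem_filter.1 hn).1⟩
      have h5 := hK (i + L) (max k (K (i + L))) (le_max_right _ _) F₂
        (Finset.mem_powerset.2 fun n hn => Finset.mem_Ico.2 (h4 n hn))
      have h7 : ∑ n ∈ F₂, c n (max k (K (Nat.find (hb n)))) =
          ∑ n ∈ F₂, c n (max k (K (i + L))) :=
        Finset.sum_congr rfl fun n hn => by rw [hbi (i + L) n (h4 n hn).1 (h4 n hn).2]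
      have h8 : ∑ n ∈ F₁, c n (max k (K (Nat.find (hb n)))) +
          ∑ n ∈ F₂, c n (max k (K (Nat.find (hb n)))) =
          ∑ n ∈ F, c n (max k (K (Nat.find (hb n)))) :=
        Finset.sum_filter_add_sum_filter_not _ _ _
      have h6 : (1 / 2 : ℝ) ^ (i + (L + 1)) = (1 / 2 : ℝ) ^ (i + L) / 2 := by
        rw [← add_assoc, pow_succ]; ring
      rw [h6, ← h8, h7]
      exact (norm_add_le _ _).trans (by linarith)
  obtain ⟨i, hi⟩ := exists_pow_lt_of_lt_one (half_pos hε) (show (1 / 2 : ℝ) < 1 by norm_num)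
  refine ⟨M i, fun F hF k => ?_⟩
  have h := key i (F.sup id + 1) k F hF fun n hn => by
    have h1 : n ≤ F.sup id := Finset.le_sup (f := id) hn
    have h2 : i + (F.sup id + 1) ≤ M (i + (F.sup id + 1)) := hM.le_apply
    omega
  have : (0 : ℝ) < (1 / 2) ^ (i + (F.sup id + 1)) := by positivity
  linarith

theorem norm_tsum_sub_sum_le_of_tail [CompleteSpace X] {c : ℕ → ℕ → X}
    (hc : ∀ ε > 0, ∃ N, ∀ F : Finset ℕ, (∀ n ∈ F, N ≤ n) → ∀ k, ‖∑ n ∈ F, c n k‖ ≤ ε)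
    {ε : ℝ} (hε : 0 < ε) :
    ∃ N, ∀ F, Finset.range N ⊆ F → ∀ k, ‖∑' n, c n k - ∑ n ∈ F, c n k‖ ≤ ε := by
  obtain ⟨N, hN⟩ := hc ε hε
  refine ⟨N, fun F hF k => ?_⟩
  have hsum : Summable fun n => c n k := by
    rw [summable_iff_vanishing_norm]
    intro δ hδ
    obtain ⟨N', hN'⟩ := hc (δ / 2) (half_pos hδ)
    refine ⟨Finset.range N', fun t ht => lt_of_le_of_lt (hN' t (fun n hn => ?_) k)
      (half_lt_self hδ)⟩
    by_contra! hlt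
    exact Finset.disjoint_left.1 ht hn (Finset.mem_range.2 hlt)
  have hlim : Tendsto (fun F' : Finset ℕ => ‖∑ n ∈ F', c n k - ∑ n ∈ F, c n k‖) atTop
      (𝓝 ‖∑' n, c n k - ∑ n ∈ F, c n k‖) := (hsum.hasSum.sub_const _).norm
  refine le_of_tendsto hlim ?_
  filter_upwards [eventually_ge_atTop F] with F' hF'
  rw [← Finset.sum_sdiff hF', add_sub_cancel_right]
  refine hN _ (fun n hn => ?_) k
  by_contra! hlt
  exact (Finset.mem_sdiff.1 hn).2 (hF (Finset.mem_range.2 hlt))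

end UniformTails

/-! ### Convergence of the sum of decoupled concentrations -/

section Decoupling

variable {𝕜 : Type*} [RCLike 𝕜] {X : Type*} [NormedAddCommGroup X] [NormedSpace 𝕜 X]

/-- Dropping terms from a sum of decoupled elementary concentrations does not increase the upper
limit of its norm. -/
theorem SatisfiesOpial.eventually_norm_sum_le (hO : SatisfiesOpial 𝕜 X)
    {G : ℕ → ℕ → X ≃ₗᵢ[𝕜] X} {z : ℕ → X}
    (hG : ∀ m n, m ≠ n → z m ≠ 0 → z n ≠ 0 → OpWeaklyNull fun k => (G m k)⁻¹ * G n k)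
    (F H : Finset ℕ) : ∀ {s ε : ℝ}, 0 < ε →
      (∀ᶠ k in atTop, ‖∑ n ∈ F ∪ H, G n k (z n)‖ ≤ s) →
      ∀ᶠ k in atTop, ‖∑ n ∈ F, G n k (z n)‖ ≤ s + ε := by
  induction H using Finset.induction_on with
  | empty =>
    intro s ε hε h
    rw [Finset.union_empty] at h
    exact h.mono fun k hk => by linarith
  | insert m H _ ih =>
    intro s ε hε h
    rw [Finset.union_insert] at h
    by_cases hm : m ∈ F ∪ H
    · rw [Finset.insert_eq_of_mem hm] at h
      exact ih hε h
    rcases eq_or_ne (z m) 0 with hzm | hzm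
    · simp only [Finset.sum_insert hm, hzm, map_zero, zero_add] at h
      exact ih hε h
    have hweak : WeaklyConverges 𝕜
        (fun k => (G m k)⁻¹ (∑ n ∈ insert m (F ∪ H), G n k (z n))) (z m) := by
      have h1 : WeaklyConverges 𝕜
          (fun k => ∑ n ∈ insert m (F ∪ H), (G m k)⁻¹ (G n k (z n)))
          (∑ n ∈ insert m (F ∪ H), if n = m then z m else 0) := by
        refine WeaklyConverges.sum fun n _ => ?_
        split_ifs with hnm
        · subst hnm
          exact (WeaklyConverges.const (z n)).congr
            (Eventually.of_forall fun k => ((G n k).inv_apply_self _).symm)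
        · rcases eq_or_ne (z n) 0 with hzn | hzn
          · simpa [hzn] using WeaklyConverges.const (𝕜 := 𝕜) (0 : X)
          · exact hG m n (Ne.symm hnm) hzm hzn (z n)
      rw [Finset.sum_ite_eq', if_pos (Finset.mem_insert_self _ _)] at h1
      simpa only [map_sum] using h1
    -- In the gauge `G m` the sum has weak limit `z m`, so Opial with comparison point `0` permits
    -- removing this term.
    have h2 := hO.eventually_norm_sub_le hweak 0 (s := s)
      (h.mono fun k hk => by rwa [sub_zero, LinearIsometryEquiv.norm_map]) (half_pos hε)
    refine (ih (s := s + ε / 2) (half_pos hε) (h2.mono fun k hk => ?_)).mono fun k hk => by linarith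
    rw [← (G m k).norm_map, map_sub, LinearIsometryEquiv.self_apply_inv,
      Finset.sum_insert hm, add_sub_cancel_left] at hk
    exact hk

namespace IsGreedyExtraction

variable {E : ℕ → Set (X ≃ₗᵢ[𝕜] X)} {u : ℕ → X} {G : ℕ → ℕ → X ≃ₗᵢ[𝕜] X} {W : ℕ → X}

theorem eventually_norm_sub_sum_le (hO : SatisfiesOpial 𝕜 X) (h : IsGreedyExtraction E u G W)
    {B : ℝ} (hB : ∀ k, ‖u k‖ ≤ B) (N : ℕ) : ∀ ε > 0, ∀ᶠ k in atTop,
      ‖u k - ∑ i ∈ Finset.range N, G i k (W i)‖ ≤ B + ε := by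
  induction N with
  | zero => exact fun ε hε => Eventually.of_forall fun k => by simpa using (hB k).trans (by linarith)
  | succ N ih =>
    intro ε hε
    have := hO.eventually_norm_sub_le (h.weaklyConverges N) 0 (s := B + ε / 2)
      ((ih _ (half_pos hε)).mono fun k hk => by rwa [sub_zero, LinearIsometryEquiv.norm_map])
      (half_pos hε)
    filter_upwards [this] with k hk
    rw [← (G N k).norm_map, map_sub, LinearIsometryEquiv.self_apply_inv] at hk
    rw [Finset.sum_range_succ, ← sub_sub]
    linarith

theorem norm_sub_sum_le (G : ℕ → ℕ → X ≃ₗᵢ[𝕜] X) (W : ℕ → X) {B : ℝ} (hB : ∀ k, ‖u k‖ ≤ B)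
    (N k : ℕ) :
    ‖u k - ∑ i ∈ Finset.range N, G i k (W i)‖ ≤ B + ∑ i ∈ Finset.range N, ‖W i‖ := by
  refine (norm_sub_le _ _).trans (add_le_add (hB k) ((norm_sum_le _ _).trans_eq ?_))
  simp only [LinearIsometryEquiv.norm_map]

/-- Let `A` be the supremum of the limiting norms of partial sums, and let that of the first `N`
terms exceed `A - η / 2`. A tail `F` of norm above `ε` for infinitely many `k` would give two
vectors of norm at most `A + η`, the partial sum with and without `F`, at distance at least `ε`.
Their midpoint has norm at most `A - η`. It is again a decoupled sum, so dropping `F` from it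
contradicts the choice of `N`. -/
theorem exists_forall_eventually_norm_sum_le [NormedSpace ℝ X] [UniformConvexSpace X]
    (hO : SatisfiesOpial 𝕜 X)
    (h : IsGreedyExtraction E u G W)
    (hdec : ∀ m n, m ≠ n → W m ≠ 0 → W n ≠ 0 → OpWeaklyNull fun k => (G m k)⁻¹ * G n k)
    {B : ℝ} (hB : ∀ k, ‖u k‖ ≤ B) {a : ℕ → ℝ}
    (ha : ∀ N, Tendsto (fun k => ‖∑ n ∈ Finset.range N, G n k (W n)‖) atTop (𝓝 (a N))) :
    ∀ ε > 0, ∃ N, ∀ F : Finset ℕ, (∀ n ∈ F, N ≤ n) →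
      ∀ᶠ k in atTop, ‖∑ n ∈ F, G n k (W n)‖ ≤ ε := by
  intro ε hε
  have hbdd : BddAbove (Set.range a) := by
    refine ⟨B + (B + 1), ?_⟩
    rintro _ ⟨N, rfl⟩
    refine le_of_tendsto (ha N) ?_
    filter_upwards [h.eventually_norm_sub_sum_le hO hB N 1 one_pos] with k hk
    have := norm_sub_le (u k) (u k - ∑ i ∈ Finset.range N, G i k (W i))
    rw [sub_sub_cancel] at this
    linarith [hB k]
  set A := ⨆ N, a N with hA
  have haA : ∀ N, a N ≤ A := le_ciSup hbdd
  obtain ⟨η, hη, H⟩ := exists_pos_forall_norm_add_lt (X := X) A hε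
  obtain ⟨N, hN⟩ := exists_lt_of_lt_ciSup (show A - η / 2 < ⨆ n, a n by rw [← hA]; linarith)
  refine ⟨N, fun F hF => ?_⟩
  by_contra hcon
  obtain ⟨φ, hφ, hφF⟩ := extraction_of_frequently_atTop (not_eventually.1 hcon)
  have hdisj : Disjoint (Finset.range N) F := Finset.disjoint_left.2 fun n h1 h2 =>
    absurd (hF n h2) (not_le.2 (Finset.mem_range.1 h1))
  have h1 : ∀ᶠ k in atTop, ‖∑ n ∈ Finset.range N, G n k (W n)‖ ≤ A + η :=
    (ha N).eventually (eventually_le_nhds (by linarith [haA N]))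
  have h2 : ∀ᶠ k in atTop, ‖∑ n ∈ Finset.range N ∪ F, G n k (W n)‖ ≤ A + η := by
    obtain ⟨N', hN'⟩ := (Finset.range N ∪ F).exists_nat_subset_range
    have h3 : ∀ᶠ k in atTop, ‖∑ n ∈ Finset.range N', G n k (W n)‖ ≤ A + η / 2 :=
      (ha N').eventually (eventually_le_nhds (by linarith [haA N']))
    have h4 := hO.eventually_norm_sum_le hdec (Finset.range N ∪ F) (Finset.range N') (s := A + η / 2)
      (half_pos hη) (by rwa [Finset.union_eq_right.2 hN'])
    exact h4.mono fun k hk => by linarith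
  -- The profiles of the midpoint: unchanged below `N`, halved on `F`.
  set z : ℕ → X := fun n => if n < N then W n else (2⁻¹ : 𝕜) • W n with hz
  have hzW : ∀ n, z n ≠ 0 → W n ≠ 0 := fun n hn h0 => hn (by simp [hz, h0])
  have hzr : ∀ k, ∑ n ∈ Finset.range N, G n k (z n) = ∑ n ∈ Finset.range N, G n k (W n) := fun k =>
    Finset.sum_congr rfl fun n hn => by rw [hz]; simp [Finset.mem_range.1 hn]
  have hzF : ∀ k, ∑ n ∈ F, G n k (z n) = (2⁻¹ : 𝕜) • ∑ n ∈ F, G n k (W n) := fun k => by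
    rw [Finset.smul_sum]
    refine Finset.sum_congr rfl fun n hn => ?_
    rw [hz]
    simp [not_lt.2 (hF n hn)]
  have h3 : ∀ᶠ j in atTop,
      ‖∑ n ∈ Finset.range N ∪ F, G n (φ j) (z n)‖ ≤ A - η := by
    filter_upwards [hφ.tendsto_atTop.eventually h1, hφ.tendsto_atTop.eventually h2] with j hj1 hj2
    have h4 := H _ _ hj1 hj2 (by
      rw [Finset.sum_union hdisj, sub_add_cancel_left, norm_neg]; exact (not_le.1 (hφF j)).le)
    have h5 : ∑ n ∈ Finset.range N, G n (φ j) (W n) + ∑ n ∈ Finset.range N ∪ F, G n (φ j) (W n) =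
        (2 : 𝕜) • ∑ n ∈ Finset.range N ∪ F, G n (φ j) (z n) := by
      rw [Finset.sum_union hdisj, Finset.sum_union hdisj, hzr, hzF, smul_add, smul_inv_smul₀ two_ne_zero,
        two_smul, add_assoc]
    rw [h5, norm_smul, RCLike.norm_ofNat] at h4
    linarith
  have h6 := hO.eventually_norm_sum_le (G := fun n j => G n (φ j)) (z := z)
    (fun m n hmn hm hn x => (hdec m n hmn (hzW m hm) (hzW n hn) x).comp hφ.tendsto_atTop)
    (Finset.range N) F (half_pos hη) h3
  simp only [hzr] at h6
  have := le_of_tendsto ((ha N).comp hφ.tendsto_atTop) h6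
  linarith

variable [NormedSpace ℝ X] [IsScalarTower ℝ 𝕜 X] [UniformConvexSpace X] [CompleteSpace X]

/-- Subtracting `W n` annihilates the weak limit in the gauge `G n`. Each later profile is nonzero
in a gauge where the remainder does not vanish weakly, hence is decoupled from `G n`, and removing
it preserves the weak limit `0`. -/
theorem weaklyConverges_zero (hX : IsUniformlySmooth X) {D₀ : Subgroup (X ≃ₗᵢ[𝕜] X)}
    (hD₀ : HasPropertyStar D₀) (hE : ∀ n, E n ⊆ D₀) (h : IsGreedyExtraction E u G W) {B : ℝ}
    (hB : ∀ k, ‖u k‖ ≤ B) {n m : ℕ} (hnm : n < m) : WeaklyConverges 𝕜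
      (fun k => (G n k)⁻¹ (u k - ∑ i ∈ Finset.range m, G i k (W i))) 0 := by
  induction m with
  | zero => omega
  | succ m ih =>
    have hs : ∀ k, (G n k)⁻¹ (u k - ∑ i ∈ Finset.range (m + 1), G i k (W i)) =
        (G n k)⁻¹ (u k - ∑ i ∈ Finset.range m, G i k (W i)) - (G n k)⁻¹ (G m k (W m)) := fun k => by
      rw [Finset.sum_range_succ, ← sub_sub, map_sub]
    simp only [hs]
    rcases (Nat.lt_succ_iff.1 hnm).eq_or_lt with rfl | hlt
    · have := (h.weaklyConverges n).sub (WeaklyConverges.const (𝕜 := 𝕜) (W n))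
      simpa only [LinearIsometryEquiv.inv_apply_self, sub_self] using this
    · rcases eq_or_ne (W m) 0 with h0 | h0
      · simpa [h0] using ih hlt
      · have := (ih hlt).sub (hD₀.opWeaklyNull hX (fun k => hE m (h.gauge_mem m k))
          (fun k => hE n (h.gauge_mem n k)) (norm_sub_sum_le G W hB m) h0 (ih hlt)
          (h.weaklyConverges m) (W m))
        rwa [sub_zero] at this

/-- Only the later profile must be nonzero. This allows the gauge of index `0` to stay in the
decomposition even when its profile is zero. -/
theorem opWeaklyNull (hX : IsUniformlySmooth X) {D₀ : Subgroup (X ≃ₗᵢ[𝕜] X)}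
    (hD₀ : HasPropertyStar D₀) (hE : ∀ n, E n ⊆ D₀) (h : IsGreedyExtraction E u G W) {B : ℝ}
    (hB : ∀ k, ‖u k‖ ≤ B) {n m : ℕ} (hnm : n < m) (hm : W m ≠ 0) :
    (OpWeaklyNull fun k => (G n k)⁻¹ * G m k) ∧ OpWeaklyNull fun k => (G m k)⁻¹ * G n k := by
  have hmem : ∀ i k, G i k ∈ D₀ := fun i k => hE i (h.gauge_mem i k)
  have h1 : OpWeaklyNull fun k => (G n k)⁻¹ * G m k :=
    hD₀.opWeaklyNull hX (hmem m) (hmem n) (norm_sub_sum_le G W hB m) hm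
      (h.weaklyConverges_zero hX hD₀ hE hB hnm) (h.weaklyConverges m)
  refine ⟨h1, ?_⟩
  have h2 := hD₀.opWeaklyNull_inv (fun k => D₀.mul_mem (D₀.inv_mem (hmem n k)) (hmem m k)) h1
  simpa only [mul_inv_rev, inv_inv] using h2

end IsGreedyExtraction

end Decoupling

/-! ### Existence of the profile decomposition -/

section Decomposition

variable {𝕜 : Type*} [RCLike 𝕜] {X : Type*} [NormedAddCommGroup X] [NormedSpace 𝕜 X]
  [NormedSpace ℝ X] [IsScalarTower ℝ 𝕜 X] [UniformConvexSpace X] [CompleteSpace X]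

/-- The full remainder is uniformly close to the `N`-th one, whose weak limits in gauges of `D` have
norm at most `2 * ‖W N‖`. This tends to zero because a single term is a tail sum. -/
theorem IsGreedyExtraction.dWeaklyNull {E : ℕ → Set (X ≃ₗᵢ[𝕜] X)} {D : Set (X ≃ₗᵢ[𝕜] X)}
    (hED : ∀ n, n ≠ 0 → E n = D) {u : ℕ → X}
    {G : ℕ → ℕ → X ≃ₗᵢ[𝕜] X} {W : ℕ → X} (h : IsGreedyExtraction E u G W)
    {B : ℝ} (hB : ∀ k, ‖u k‖ ≤ B)
    (htail : ∀ ε > 0, ∃ N, ∀ F : Finset ℕ, (∀ n ∈ F, N ≤ n) →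
      ∀ k, ‖∑ n ∈ F, G n k (W n)‖ ≤ ε) :
    DWeaklyNull D fun k => u k - ∑' n, G n k (W n) := by
  obtain ⟨N₁, hN₁⟩ := norm_tsum_sub_sum_le_of_tail htail one_pos
  have hrB : ∀ k, ‖u k - ∑' n, G n k (W n)‖ ≤ (B + ∑ i ∈ Finset.range N₁, ‖W i‖) + 1 := fun k => by
    have h1 := norm_sub_sum_le G W hB N₁ k
    have h2 := hN₁ _ subset_rfl k
    rw [← sub_sub_sub_cancel_right _ _ (∑ n ∈ Finset.range N₁, G n k (W n))]
    exact (norm_sub_le _ _).trans (add_le_add h1 h2)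
  intro g hg f
  rw [map_zero]
  refine tendsto_of_subseq_tendsto fun φ hφ => ?_
  obtain ⟨a, ψ, hψ, ha⟩ := exists_weaklyConverges_subseq (𝕜 := 𝕜)
    (x := fun j => (g (φ j))⁻¹ (u (φ j) - ∑' n, G n (φ j) (W n)))
    (fun j => by rw [LinearIsometryEquiv.norm_map]; exact hrB _)
  have hφψ : Tendsto (fun j => φ (ψ j)) atTop atTop := hφ.comp hψ.tendsto_atTop
  have ha0 : a = 0 := by
    rw [← norm_le_zero_iff]
    refine le_of_forall_pos_le_add fun ε hε => ?_
    obtain ⟨N₂, hN₂⟩ := norm_tsum_sub_sum_le_of_tail htail (half_pos hε)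
    obtain ⟨N₃, hN₃⟩ := htail (ε / 4) (by positivity)
    -- `N ≥ 1` is needed because stage `0` may use a gauge set other than `D`.
    set N := max (max N₂ N₃) 1 with hN
    have hWN : ‖W N‖ ≤ ε / 4 := by
      simpa using hN₃ {N} (by simp [hN]) 0
    obtain ⟨b, χ, hχ, hb⟩ := exists_weaklyConverges_subseq (𝕜 := 𝕜)
      (x := fun j => (g (φ (ψ j)))⁻¹
        (u (φ (ψ j)) - ∑ n ∈ Finset.range N, G n (φ (ψ j)) (W n)))
      (fun j => by rw [LinearIsometryEquiv.norm_map]; exact norm_sub_sum_le G W hB N _)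
    have hbN : ‖b‖ ≤ 2 * ‖W N‖ := h.norm_le N b
      ⟨fun j => φ (ψ (χ j)), hφψ.comp hχ.tendsto_atTop, fun j => g (φ (ψ (χ j))), fun j => by
        rw [hED N (by simp [hN])]; exact hg _, hb⟩
    have hab := (ha.comp hχ.tendsto_atTop).sub hb
    have habn : ‖a - b‖ ≤ ε / 2 := by
      refine hab.norm_le (Eventually.frequently (Eventually.of_forall fun j => ?_))
      rw [← map_sub, LinearIsometryEquiv.norm_map, sub_sub_sub_cancel_left, norm_sub_rev]
      exact hN₂ _ (Finset.range_subset_range.2 (by simp [hN])) _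
    have := norm_add_le (a - b) b
    rw [sub_add_cancel] at this
    linarith
  refine ⟨ψ, ?_⟩
  have := ha f
  rwa [ha0, map_zero] at this

theorem exists_isProfileDecomposition (hX : IsUniformlySmooth X) (hO : SatisfiesOpial 𝕜 X)
    {D₀ : Subgroup (X ≃ₗᵢ[𝕜] X)} (hD₀ : HasPropertyStar D₀) {D : Set (X ≃ₗᵢ[𝕜] X)}
    (hD : D ⊆ D₀) (hI : 1 ∈ D) {u : ℕ → X} {B : ℝ} (hB : ∀ k, ‖u k‖ ≤ B) :
    ∃ (φ : ℕ → ℕ) (S : Set ℕ) (g : ℕ → ℕ → X ≃ₗᵢ[𝕜] X) (w : ℕ → X) (r : ℕ → X),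
      StrictMono φ ∧ IsProfileDecomposition D (u ∘ φ) S g w r := by
  -- Restricting stage `0` to the identity forces the first gauge to be `I`.
  let E : ℕ → Set (X ≃ₗᵢ[𝕜] X) := fun n => if n = 0 then {1} else D
  have hE1 : ∀ n, 1 ∈ E n := fun n => by
    by_cases hn : n = 0 <;> simp [E, hn, hI]
  have hED : ∀ n, E n ⊆ D := fun n => by
    by_cases hn : n = 0 <;> simp [E, hn, hI]
  have hED' : ∀ n, n ≠ 0 → E n = D := fun n hn => by simp [E, hn]
  have hED₀ : ∀ n, E n ⊆ D₀ := fun n => (hED n).trans hD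
  obtain ⟨φ, G₀, W, hφ, h₀⟩ := exists_isGreedyExtraction hE1 hB
  -- Compactness of a product of intervals gives one subsequence along which the norms of all
  -- partial sums converge.
  obtain ⟨a, -, ρ, hρ, ha⟩ := (isCompact_univ_pi fun N : ℕ =>
    isCompact_Icc (a := (0 : ℝ)) (b := ∑ i ∈ Finset.range N, ‖W i‖)).isSeqCompact
    (x := fun k N => ‖∑ n ∈ Finset.range N, G₀ n k (W n)‖) (fun k N _ =>
      ⟨norm_nonneg _, (norm_sum_le _ _).trans_eq
        (by simp only [LinearIsometryEquiv.norm_map])⟩)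
  have h₁ := h₀.comp hρ.tendsto_atTop
  set G₁ : ℕ → ℕ → X ≃ₗᵢ[𝕜] X := fun n k => G₀ n (ρ k) with hG₁
  have hB₁ : ∀ k, ‖u (φ (ρ k))‖ ≤ B := fun k => hB _
  have hdec : ∀ m n, m ≠ n → W m ≠ 0 → W n ≠ 0 →
      OpWeaklyNull fun k => (G₁ m k)⁻¹ * G₁ n k := fun m n hmn hm hn => by
    rcases hmn.lt_or_gt with hlt | hlt
    · exact (h₁.opWeaklyNull hX hD₀ hED₀ hB₁ hlt hn).1
    · exact (h₁.opWeaklyNull hX hD₀ hED₀ hB₁ hlt hm).2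
  obtain ⟨K, hK⟩ := exists_shift_forall_norm_sum_le (c := fun n k => G₁ n k (W n))
    (h₁.exists_forall_eventually_norm_sum_le hO hdec hB₁ fun N => (tendsto_pi_nhds.1 ha) N)
  -- For each `n` only finitely many gauges change, so all weak limits persist; the remainder
  -- absorbs the difference.
  set G : ℕ → ℕ → X ≃ₗᵢ[𝕜] X := fun n k => G₁ n (max k (K n)) with hG
  have h := h₁.congr_gauge (G' := G) (fun n k => h₁.gauge_mem n _) fun n => by
    filter_upwards [eventually_ge_atTop (K n)] with k hk
    rw [hG]
    simp [max_eq_left hk]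
  -- Zero profiles of positive index are left out of `S`, since property (*) gives no decoupling for
  -- their gauges.
  refine ⟨φ ∘ ρ, {n | n = 0 ∨ W n ≠ 0}, G, W, fun k => u (φ (ρ k)) - ∑' n, G n k (W n),
    hφ.comp hρ, ?_⟩
  exact
    { gauge_mem := fun n k => hED n (h.gauge_mem n k)
      zero_mem := Or.inl rfl
      gauge_zero := fun k => by simpa [E] using h.gauge_mem 0 k
      profile_eq_zero := fun n hn => by
        by_contra h0
        exact hn (Or.inr h0)
      decoupled := fun n hn m hm hmn => by
        rcases hmn.lt_or_gt with hlt | hlt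
        · exact (h.opWeaklyNull hX hD₀ hED₀ hB₁ hlt (hn.resolve_left (by omega))).2
        · exact (h.opWeaklyNull hX hD₀ hED₀ hB₁ hlt (hm.resolve_left (by omega))).1
      tendstoUniformly := by
        rw [Metric.tendstoUniformly_iff]
        intro ε hε
        obtain ⟨N, hN⟩ := norm_tsum_sub_sum_le_of_tail (c := fun n k => G n k (W n)) hK
          (half_pos hε)
        filter_upwards [eventually_ge_atTop (Finset.range N)] with F hF k
        rw [dist_eq_norm]
        exact (hN F hF k).trans_lt (half_lt_self hε)
      eq_sum_add := fun k => by simp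
      remainder := h.dWeaklyNull hED' hB₁ hK }

end Decomposition

theorem mainTheorem2 {𝕜 : Type*} [RCLike 𝕜] {X : Type u} [NormedAddCommGroup X]
    [NormedSpace 𝕜 X] [CompleteSpace X] [UniformConvexSpace X]
    (hsmooth : IsUniformlySmooth X) (hOpial : SatisfiesOpial 𝕜 X)
    (D₀ : Subgroup (X ≃ₗᵢ[𝕜] X)) (hD₀ : HasPropertyStar D₀)
    (D : Set (X ≃ₗᵢ[𝕜] X)) (hD : D ⊆ D₀) (hI : 1 ∈ D) :
    -- every bounded sequence has a subsequence with a profile decomposition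
    (∀ u : ℕ → X, Bornology.IsBounded (Set.range u) →
      ∃ (φ : ℕ → ℕ) (S : Set ℕ) (g : ℕ → ℕ → X ≃ₗᵢ[𝕜] X) (w : ℕ → X) (r : ℕ → X),
        StrictMono φ ∧ IsProfileDecomposition D (u ∘ φ) S g w r) ∧
    -- the energy bound, for every profile decomposition
    (∀ u : ℕ → X, (∀ k, ‖u k‖ ≤ 1) →
      ∀ (φ : ℕ → ℕ) (S : Set ℕ) (g : ℕ → ℕ → X ≃ₗᵢ[𝕜] X) (w : ℕ → X) (r : ℕ → X),
        StrictMono φ → IsProfileDecomposition D (u ∘ φ) S g w r →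
          (∀ n, ‖w n‖ ≤ 2) ∧
          limsup (fun k => ‖r k‖ₑ) atTop
            + ∑' n, ENNReal.ofReal (modulusOfConvexity X ‖w n‖) ≤ 1) ∧
    -- under a cocompact imbedding the remainder vanishes in norm
    (∀ (Y : Type v) [NormedAddCommGroup Y] [NormedSpace 𝕜 Y] [CompleteSpace Y]
      (j : X →L[𝕜] Y), IsCocompactImbedding D j →
      ∀ u : ℕ → X, Bornology.IsBounded (Set.range u) →
      ∀ (φ : ℕ → ℕ) (S : Set ℕ) (g : ℕ → ℕ → X ≃ₗᵢ[𝕜] X) (w : ℕ → X) (r : ℕ → X),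
        StrictMono φ → IsProfileDecomposition D (u ∘ φ) S g w r →
          Tendsto (fun k => ‖j (r k)‖) atTop (𝓝 0)) := by
  -- Convexity arguments use the underlying real structure; uniform convexity depends only on the
  -- norm.
  let _ : NormedSpace ℝ X := NormedSpace.restrictScalars ℝ 𝕜 X
  have : IsScalarTower ℝ 𝕜 X := ⟨fun a b x => by
    change (a • b) • x = algebraMap ℝ 𝕜 a • b • x
    rw [Algebra.smul_def, mul_smul]⟩
  refine ⟨fun u hu => ?_, fun u hu φ S g w r _ h => ⟨fun n => ?_, ?_⟩,
    fun Y _ _ _ j hj u _ φ S g w r _ h => hj.tendsto_zero r h.remainder⟩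
  · obtain ⟨B, hB⟩ := hu.exists_norm_le
    exact exists_isProfileDecomposition hsmooth hOpial hD₀ hD hI fun k => hB _ ⟨k, rfl⟩
  -- Weak lower semicontinuity of the norm already gives the bound `1`.
  · exact (h.norm_profile_le zero_le_one (fun k => hu (φ k)) n).trans one_le_two
  · exact h.limsup_add_tsum_le hOpial fun k => hu (φ k)
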